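/- A chord diagram is an oriented circle with finitely many chords with pairwise distinct ends, up to orientation preserving diffeomorphisms of the circle; it is the closure of an arc diagram, that is, of a fixed-point-free involution of the set $\{1,\dots,m\}$ of ends. Let $\mathcal A$ be the complex vector space spanned by chord diagrams modulo the 4-term relations, with the product given by concatenation and the coproduct given by splitting the set of chords into two disjoint subsets in all possible ways. Let $P(\mathcal A)$ be the subspace of primitive elements, let $D(\mathcal A)$ be the subspace of decomposable elements (spanned by the unit and the products of two nonempty diagrams), and let $\pi:\mathcal A\to P(\mathcal A)$ be the projection onto $P(\mathcal A)$ with kernel $D(\mathcal A)$. For a permutation $\alpha\in\mathbb S_m$ put $w_{\mathfrak{gl}(N)}(\alpha)=\sum_{i_1,\dots,i_m=1}^N E_{i_1i_{\alpha(1)}}\cdots E_{i_mi_{\alpha(m)}}\in U\mathfrak{gl}(N)$, where $E_{ij}$ are the matrix units, and let $C_k=w_{\mathfrak{gl}(N)}((1,2,\dots,k))$. Let $w_{\mathfrak{gl}}(\alpha)\in\mathbb C[N,C_1,C_2,\dots]$ be the universal $\mathfrak{gl}$-weight system, that is, the polynomial which becomes $w_{\mathfrak{gl}(N)}(\alpha)$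 for every $N\ge1$. Let $F_\varepsilon(\alpha)\in\mathbb C[N][\varepsilon]$ be the result of the substitution $$C_k:=\tfrac1N\bigl((N+\varepsilon)^k-(1-N^2)\varepsilon^k\bigr),\qquad k=1,2,\dots,$$ in $w_{\mathfrak{gl}}(\alpha)$, and let $F(\alpha)\in\mathbb C[N]$ be the polynomial whose value at each integer $N\ge1$ is $\frac1N$ times the trace of $w_{\mathfrak{gl}(N)}(\alpha)$ in the standard representation of $\mathfrak{gl}(N)$. **Theorem.** The projection $\pi$ exists and is unique, and $F_\varepsilon$ and $F$ extend, uniquely, to linear maps on $\mathcal A$. For every chord diagram $B$ with at least two chords, the value $F_\varepsilon(\pi(B))$ does not depend on $\varepsilon$, and it is equal to $F(\pi(B))$. For the chord diagram $K_1$ with a single chord, $F_\varepsilon(\pi(K_1))=F_\varepsilon(K_1)=N+2\varepsilon+N\varepsilon^2$. -/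

import Mathlib

open scoped TensorProduct Polynomial

noncomputable section

namespace ChordHopf

/-! ### Arc diagrams and chord diagrams -/

/-- An arc diagram, written as a double occurrence word: the ends of the arcs are read from left
to right along the line, and each end is labelled by (the name of) its arc. -/
structure ArcDiagram where
  word : List ℕ
  count_eq_two : ∀ a ∈ word, word.count a = 2

namespace ArcDiagram

/-- The empty diagram. -/
def empty : ArcDiagram := ⟨[], by simp⟩

/-- The diagram with a single arc. -/
def oneArc : ArcDiagram := ⟨[0, 0], by simp⟩

/-- The diagram consisting of the arcs of `D` whose names belong to `S`. -/
def restrict (D : ArcDiagram) (S : Finset ℕ) : ArcDiagram where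
  word := D.word.filter (· ∈ S)
  count_eq_two a ha := by
    rw [List.mem_filter] at ha
    rw [List.count_filter (p := (· ∈ S)) ha.2]
    exact D.count_eq_two a ha.1

theorem exists_other (D : ArcDiagram) (i : Fin D.word.length) :
    ∃ j : Fin D.word.length, Finset.univ.filter (fun k => D.word.get k = D.word.get i) = {i, j} ∧
      i ≠ j := by
  have h : (Finset.univ.filter (fun k => D.word.get k = D.word.get i)).card = 2 := by
    rw [← D.count_eq_two (D.word.get i) (List.get_mem _ _)]
    have e := Fin.card_filter_univ_eq_vector_get_eq_count (D.word.get i)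
      (⟨D.word, rfl⟩ : List.Vector ℕ D.word.length)
    rw [List.Vector.toList_mk] at e
    rw [← e]
    congr 1
  obtain ⟨x, y, hxy, hs⟩ := Finset.card_eq_two.mp h
  have hi : i ∈ Finset.univ.filter (fun k => D.word.get k = D.word.get i) := by simp
  rw [hs, Finset.mem_insert, Finset.mem_singleton] at hi
  rcases hi with rfl | rfl
  · exact ⟨y, hs, hxy⟩
  · exact ⟨x, by rw [hs, Finset.pair_comm], hxy.symm⟩

/-- The other end of the arc ending at the `i`-th point. -/
def other (D : ArcDiagram) (i : Fin D.word.length) : Fin D.word.length :=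
  (D.exists_other i).choose

theorem other_eq_iff (D : ArcDiagram) (i j : Fin D.word.length) :
    D.other i = j ↔ j ≠ i ∧ D.word.get j = D.word.get i := by
  have h := (D.exists_other i).choose_spec
  change _ = {i, D.other i} ∧ i ≠ D.other i at h
  have hj := congrArg (fun s => j ∈ s) h.1
  simp only [Finset.mem_filter, Finset.mem_univ, true_and, Finset.mem_insert,
    Finset.mem_singleton, eq_iff_iff] at hj
  rw [hj]
  constructor
  · rintro rfl
    exact ⟨h.2.symm, Or.inr rfl⟩
  · rintro ⟨h1, h2⟩
    exact (h2.resolve_left h1).symm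

/-- The arc diagram as an involution without fixed points on the set of the arc ends. -/
def perm (D : ArcDiagram) : Equiv.Perm (Fin D.word.length) :=
  Function.Involutive.toPerm D.other fun i => by
    have h := (D.other_eq_iff i _).mp rfl
    exact (D.other_eq_iff _ _).mpr ⟨h.1.symm, h.2.symm⟩

end ArcDiagram

/-- Two arc diagrams close up to the same chord diagram if they differ by renaming the arcs and
by moving the leftmost end to the right end of the line. -/
inductive ClosureStep : ArcDiagram → ArcDiagram → Prop
  | rename (D D' : ArcDiagram) (f : ℕ → ℕ) (hf : Function.Injective f)
      (h : D'.word = D.word.map f) : ClosureStep D D'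
  | rotate (D D' : ArcDiagram) (a : ℕ) (u : List ℕ)
      (h : D.word = a :: u) (h' : D'.word = u ++ [a]) : ClosureStep D D'

/-- Chord diagrams: an oriented circle with finitely many chords having disjoint ends, up to
orientation preserving diffeomorphisms of the circle. -/
def ChordDiagram : Type := Quot ClosureStep

/-- The chord diagram obtained by closing the line of an arc diagram into a circle. -/
def ArcDiagram.close (D : ArcDiagram) : ChordDiagram := Quot.mk _ D

/-- The number of chords. -/
def ChordDiagram.numChords : ChordDiagram → ℕ :=
  Quot.lift (fun D => D.word.length / 2) fun D D' h => by
    cases h with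
    | rename f hf h => simp [h]
    | rotate a u h h' => simp [h, h']

/-! ### Chord diagrams modulo the four-term relations, their coalgebra structure -/

/-- The span of the four-term relations: one end of the chord `a` is placed on either side of
either end of the chord `b`, everything else being kept. -/
def fourTerm : Submodule ℂ (ChordDiagram →₀ ℂ) :=
  Submodule.span ℂ {z | ∃ (D₁ D₂ D₃ D₄ : ArcDiagram) (u v w : List ℕ) (a b : ℕ),
    D₁.word = u ++ [a, b] ++ v ++ [b] ++ w ∧
    D₂.word = u ++ [b, a] ++ v ++ [b] ++ w ∧
    D₃.word = u ++ [b] ++ v ++ [a, b] ++ w ∧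
    D₄.word = u ++ [b] ++ v ++ [b, a] ++ w ∧
    z = (Finsupp.single D₁.close 1 - Finsupp.single D₂.close 1) +
      (Finsupp.single D₃.close 1 - Finsupp.single D₄.close 1)}

/-- The space spanned by chord diagrams modulo the four-term relations. -/
abbrev ChordSpace : Type := (ChordDiagram →₀ ℂ) ⧸ fourTerm

/-- The class of a chord diagram. -/
def ChordDiagram.cls (B : ChordDiagram) : ChordSpace := fourTerm.mkQ (Finsupp.single B 1)

/-- The unit of the Hopf algebra: the class of the empty chord diagram. -/
def unit : ChordSpace := ArcDiagram.empty.close.cls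

/-- The sum over all ways to split the set of chords into two disjoint subsets. -/
def ArcDiagram.split (D : ArcDiagram) : ChordSpace ⊗[ℂ] ChordSpace :=
  ∑ S ∈ D.word.toFinset.powerset,
    (D.restrict S).close.cls ⊗ₜ[ℂ] (D.restrict (D.word.toFinset \ S)).close.cls

theorem close_eq_of_step {D D' : ArcDiagram} (h : ClosureStep D D') : D.close = D'.close :=
  Quot.sound h

theorem close_eq_of_word {D D' : ArcDiagram} (h : D.word = D'.word) : D.close = D'.close := by
  cases D; cases D'; cases h; rfl

theorem split_congr (D D' : ArcDiagram) (h : ClosureStep D D') : D.split = D'.split := by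
  cases h with
  | rename f hf h =>
    unfold ArcDiagram.split
    have hs : D'.word.toFinset = D.word.toFinset.image f := by
      ext; simp [h]
    rw [hs, Finset.powerset_image, Finset.sum_image (fun s _ t _ hst =>
      Finset.image_injective hf hst)]
    refine Finset.sum_congr rfl fun S _ => ?_
    have key : ∀ T : Finset ℕ, (D.restrict T).close = (D'.restrict (T.image f)).close := by
      intro T
      refine close_eq_of_step (.rename _ _ f hf ?_)
      simp only [ArcDiagram.restrict, h, List.filter_map]
      congr 1
      refine List.filter_congr fun x _ => ?_
      simp [hf.eq_iff]
    rw [key, key, Finset.image_sdiff _ _ hf]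
  | rotate a u h h' =>
    unfold ArcDiagram.split
    have hs : D'.word.toFinset = D.word.toFinset := by
      ext; simp [h, h']
    rw [hs]
    have key : ∀ T : Finset ℕ, (D.restrict T).close = (D'.restrict T).close := by
      intro T
      by_cases ha : a ∈ T
      · refine close_eq_of_step (.rotate _ _ a (u.filter (· ∈ T)) ?_ ?_)
        · simp [ArcDiagram.restrict, h, ha]
        · simp [ArcDiagram.restrict, h', ha]
      · refine close_eq_of_word ?_
        simp [ArcDiagram.restrict, h, h', ha]
    refine Finset.sum_congr rfl fun S _ => ?_
    rw [key, key]

/-- The sum over all ways to split the set of chords of a chord diagram into two subsets. -/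
def ChordDiagram.split : ChordDiagram → ChordSpace ⊗[ℂ] ChordSpace :=
  Quot.lift ArcDiagram.split split_congr

theorem cls_four {D₁ D₂ D₃ D₄ : ArcDiagram} (u v w : List ℕ) (a b : ℕ)
    (h₁ : D₁.word = u ++ [a, b] ++ v ++ [b] ++ w)
    (h₂ : D₂.word = u ++ [b, a] ++ v ++ [b] ++ w)
    (h₃ : D₃.word = u ++ [b] ++ v ++ [a, b] ++ w)
    (h₄ : D₄.word = u ++ [b] ++ v ++ [b, a] ++ w) :
    (D₁.close.cls - D₂.close.cls) + (D₃.close.cls - D₄.close.cls) = 0 := by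
  simp only [ChordDiagram.cls, ← map_sub, ← map_add]
  rw [Submodule.mkQ_apply, Submodule.Quotient.mk_eq_zero]
  exact Submodule.subset_span ⟨D₁, D₂, D₃, D₄, u, v, w, a, b, h₁, h₂, h₃, h₄, rfl⟩

theorem fourTerm_le_ker :
    fourTerm ≤ LinearMap.ker (Finsupp.linearCombination ℂ ChordDiagram.split) := by
  refine Submodule.span_le.mpr ?_
  rintro z ⟨D₁, D₂, D₃, D₄, u, v, w, a, b, h₁, h₂, h₃, h₄, rfl⟩
  have e : ∀ D : ArcDiagram, D.close.split = D.split := fun D => rfl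
  simp only [SetLike.mem_coe, LinearMap.mem_ker, map_add, map_sub,
    Finsupp.linearCombination_single, one_smul, e]
  unfold ArcDiagram.split
  have s₂ : D₂.word.toFinset = D₁.word.toFinset := by
    ext; simp only [h₁, h₂, List.mem_toFinset, List.mem_append, List.mem_cons]; tauto
  have s₃ : D₃.word.toFinset = D₁.word.toFinset := by
    ext; simp only [h₁, h₃, List.mem_toFinset, List.mem_append, List.mem_cons]; tauto
  have s₄ : D₄.word.toFinset = D₁.word.toFinset := by
    ext; simp only [h₁, h₄, List.mem_toFinset, List.mem_append, List.mem_cons]; tauto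
  have ha : a ∈ D₁.word.toFinset := by simp [h₁]
  have hb : b ∈ D₁.word.toFinset := by simp [h₁]
  rw [s₂, s₃, s₄, ← Finset.sum_sub_distrib, ← Finset.sum_sub_distrib, ← Finset.sum_add_distrib]
  -- restriction to a set containing both chords
  have both : ∀ T : Finset ℕ, a ∈ T → b ∈ T →
      ((D₁.restrict T).close.cls - (D₂.restrict T).close.cls) +
        ((D₃.restrict T).close.cls - (D₄.restrict T).close.cls) = 0 := by
    intro T hat hbt
    refine cls_four (u.filter (· ∈ T)) (v.filter (· ∈ T)) (w.filter (· ∈ T)) a b ?_ ?_ ?_ ?_ <;>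
      simp [ArcDiagram.restrict, h₁, h₂, h₃, h₄, hat, hbt]
  have pair : ∀ T : Finset ℕ, a ∉ T ∨ b ∉ T →
      (D₁.restrict T).close = (D₂.restrict T).close ∧
      (D₃.restrict T).close = (D₄.restrict T).close := by
    rintro T (hT | hT) <;> constructor <;> refine close_eq_of_word ?_ <;>
      simp [ArcDiagram.restrict, h₁, h₂, h₃, h₄, List.filter_cons, hT]
  have all : ∀ T : Finset ℕ, a ∉ T →
      (D₁.restrict T).close = (D₃.restrict T).close := by
    intro T hT
    refine close_eq_of_word ?_
    simp [ArcDiagram.restrict, h₁, h₃, List.filter_cons, hT]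
  refine Finset.sum_eq_zero fun S _ => ?_
  by_cases haS : a ∈ S <;> by_cases hbS : b ∈ S
  · have hT : a ∉ D₁.word.toFinset \ S := by simp [haS]
    rw [← (pair _ (Or.inl hT)).2, ← (pair _ (Or.inl hT)).1, ← all _ hT,
      ← TensorProduct.sub_tmul, ← TensorProduct.sub_tmul, ← TensorProduct.add_tmul,
      both S haS hbS, TensorProduct.zero_tmul]
  · have hT : a ∉ D₁.word.toFinset \ S := by simp [haS]
    rw [← (pair _ (Or.inl hT)).2, ← (pair _ (Or.inl hT)).1, ← all _ hT,
      ← (pair S (Or.inr hbS)).1, ← (pair S (Or.inr hbS)).2, sub_self, sub_self, add_zero]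
  · have hT : b ∉ D₁.word.toFinset \ S := by simp [hbS]
    rw [← (pair _ (Or.inr hT)).2, ← (pair _ (Or.inr hT)).1,
      ← (pair S (Or.inl haS)).1, ← (pair S (Or.inl haS)).2, sub_self, sub_self, add_zero]
  · have haT : a ∈ D₁.word.toFinset \ S := Finset.mem_sdiff.mpr ⟨ha, haS⟩
    have hbT : b ∈ D₁.word.toFinset \ S := Finset.mem_sdiff.mpr ⟨hb, hbS⟩
    rw [← (pair S (Or.inl haS)).2, ← (pair S (Or.inl haS)).1, ← all S haS,
      ← TensorProduct.tmul_sub, ← TensorProduct.tmul_sub, ← TensorProduct.tmul_add,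
      both _ haT hbT, TensorProduct.tmul_zero]

/-- The comultiplication. -/
def comul : ChordSpace →ₗ[ℂ] ChordSpace ⊗[ℂ] ChordSpace :=
  fourTerm.liftQ (Finsupp.linearCombination ℂ ChordDiagram.split) fourTerm_le_ker

/-- The subspace of primitive elements. -/
def primitives : Submodule ℂ ChordSpace :=
  LinearMap.eqLocus comul
    ((TensorProduct.mk ℂ ChordSpace ChordSpace unit) +
      (TensorProduct.mk ℂ ChordSpace ChordSpace).flip unit)

/-- The subspace of decomposable elements: it is spanned by the unit (degree `0`) and by the
products, that is, the concatenations, of two nonempty diagrams. -/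
def decomposables : Submodule ℂ ChordSpace :=
  Submodule.span ℂ ({unit} ∪ {z | ∃ D D₁ D₂ : ArcDiagram, D₁.word ≠ [] ∧ D₂.word ≠ [] ∧
    D.word = D₁.word ++ D₂.word ∧ z = D.close.cls})

/-- The projection onto the subspace of primitive elements whose kernel is the subspace of
decomposable elements. -/
def IsPrimitiveProjection (π : ChordSpace →ₗ[ℂ] ChordSpace) : Prop :=
  LinearMap.IsProj primitives π ∧ LinearMap.ker π = decomposables

/-! ### The `gl` weight system -/

attribute [local instance 100] LieRing.ofAssociativeRing

/-- The universal enveloping algebra of `gl(N)`; the bracket of matrices is the commutator. -/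
abbrev Ugl (N : ℕ) : Type := UniversalEnvelopingAlgebra ℂ (Matrix (Fin N) (Fin N) ℂ)

/-- The matrix unit `E_{ij}`, as an element of the universal enveloping algebra. -/
def matrixUnit (N : ℕ) (i j : Fin N) : Ugl N :=
  UniversalEnvelopingAlgebra.ι ℂ (Matrix.single i j (1 : ℂ))

/-- The `gl(N)` weight system of a permutation:
the sum of `E_{i₁ i_{α(1)}} ⋯ E_{i_m i_{α(m)}}` over all `i₁, …, i_m`. -/
def glWeight (N : ℕ) {m : ℕ} (α : Equiv.Perm (Fin m)) : Ugl N :=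
  ∑ i : Fin m → Fin N, (List.ofFn fun k => matrixUnit N (i k) (i (α k))).prod

/-- The Casimir element `C_k`: the value at the standard cycle of length `k`. -/
def casimir (N k : ℕ) : Ugl N := glWeight N (finRotate k)

/-- `p`, a polynomial in `N = X 0` and the `C_k = X k` for `k ≥ 1`, becomes the value of the
`gl(N)` weight system at `α` in the universal enveloping algebra of `gl(N)`, for every `N ≥ 1`. -/
def IsUniversalValue {m : ℕ} (α : Equiv.Perm (Fin m)) (p : MvPolynomial ℕ ℂ) : Prop :=
  ∀ N : ℕ, 1 ≤ N → ∃ φ : MvPolynomial ℕ ℂ →ₐ[ℂ] Ugl N,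
    φ (MvPolynomial.X 0) = (N : Ugl N) ∧
    (∀ k : ℕ, 1 ≤ k → φ (MvPolynomial.X k) = casimir N k) ∧
    φ p = glWeight N α

/-- The universal `gl` weight system: the polynomial in `N, C₁, C₂, …` that specializes to the
`gl(N)` weight system for every `N`. -/
def universalGl {m : ℕ} (α : Equiv.Perm (Fin m)) : MvPolynomial ℕ ℂ :=
  Classical.epsilon (IsUniversalValue α)

/-! ### The weight systems `F` and `F_ε` -/

/-- The variable `N`, in the ring `ℂ[N][ε]`. -/
def varN : ℂ[X][X] := Polynomial.C Polynomial.X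

/-- The variable `ε`, in the ring `ℂ[N][ε]`. -/
def varEps : ℂ[X][X] := Polynomial.X

/-- The value substituted for `C_k`, namely `((N + ε)^k - (1 - N²) ε^k) / N`. -/
def casimirSubst (k : ℕ) : ℂ[X][X] :=
  ∑ i ∈ Finset.Icc 1 k, (k.choose i : ℂ[X][X]) * varN ^ (i - 1) * varEps ^ (k - i) +
    varN * varEps ^ k

theorem varN_mul_casimirSubst (k : ℕ) :
    varN * casimirSubst k = (varN + varEps) ^ k - (1 - varN ^ 2) * varEps ^ k := by
  rw [casimirSubst, add_pow, Finset.range_eq_Ico, Finset.sum_eq_sum_Ico_succ_bot (by omega)]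
  have : Finset.Ico (0 + 1) (k + 1) = Finset.Icc 1 k := by ext; simp [Nat.succ_le_iff]
  rw [this, mul_add, Finset.mul_sum]
  have h : ∀ i ∈ Finset.Icc 1 k,
      varN * ((k.choose i : ℂ[X][X]) * varN ^ (i - 1) * varEps ^ (k - i)) =
        varN ^ i * varEps ^ (k - i) * (k.choose i : ℂ[X][X]) := by
    intro i hi
    obtain ⟨j, rfl⟩ : ∃ j, i = j + 1 := ⟨i - 1, by simp at hi; omega⟩
    simp only [Nat.add_sub_cancel]
    ring
  rw [Finset.sum_congr rfl h]
  simp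
  ring

/-- `F_ε(α)`, a polynomial in `N` and `ε`: the result of substituting `casimirSubst k` for `C_k`
in the value of the universal `gl` weight system. -/
def Feps {m : ℕ} (α : Equiv.Perm (Fin m)) : ℂ[X][X] :=
  MvPolynomial.aeval (fun k : ℕ => if k = 0 then varN else casimirSubst k) (universalGl α)

/-- The standard representation of `gl(N)`, extended to the universal enveloping algebra. -/
def standardRep (N : ℕ) : Ugl N →ₐ[ℂ] Matrix (Fin N) (Fin N) ℂ :=
  UniversalEnvelopingAlgebra.lift ℂ LieHom.id

/-- The normalized trace of the standard representation. -/
def normTrace (N : ℕ) (a : Ugl N) : ℂ := (standardRep N a).trace / N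

/-- `G` is the linear extension of `F_ε` to chord diagrams modulo the four-term relations. -/
def IsFeps (G : ChordSpace →ₗ[ℂ] ℂ[X][X]) : Prop :=
  ∀ D : ArcDiagram, G D.close.cls = Feps D.perm

/-- `G` is the linear extension of `F` to chord diagrams modulo the four-term relations;
`F(α)` is the polynomial in `N` whose value at each `N ≥ 1` is the normalized trace, in the
standard representation, of the value of the `gl(N)` weight system at `α`. -/
def IsF (G : ChordSpace →ₗ[ℂ] ℂ[X]) : Prop :=
  ∀ (D : ArcDiagram) (N : ℕ), 1 ≤ N →
    (G D.close.cls).eval (N : ℂ) = normTrace N (glWeight N D.perm)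

end ChordHopf

end

open scoped TensorProduct Polynomial

noncomputable section

namespace ChordHopf

attribute [local instance 100] LieRing.ofAssociativeRing

/-! ### The product of chord diagrams modulo the four-term relations -/

/-! For fixed `N` and `ε`, the assignment `x ↦ x + ε tr(x)·1` is a representation of `gl(N)` on
`ℂ^N`. The matrix `E` whose entries are the matrix units of the standard representation satisfies
`E² = N E` and has trace the identity. So `C_k`, the trace of `(E + ε)^k`, acts by exactly the
scalar substituted for `C_k` (`shiftedRep_casimir`). Hence `F_ε` is the normalized trace of the
weight system in the twisted representation, and `F` is its value at `ε = 0`. The four-term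
relations hold because `∑ E_ij ⊗ E_ji` is invariant, and rotation invariance is cyclicity of the
trace.

Twisting one chord changes `∑ E_ij ⊗ E_ji` by the scalar `2ε + Nε²`, because `∑ E_ii` acts as the
identity. Expanding over all chords shows that `F_ε` is the convolution of `F` with the map sending
a diagram with `n` chords to `(2ε + Nε²)^n` (`isFeps_eq_convolution`). On a primitive `x` a
convolution of unital maps is a sum, so `F_ε(x) = F(x) + p(2ε + Nε²)`, where `p` is the polynomial
counting chords. The binomial theorem makes `p` additive on primitives, hence `p = cX`.
Decomposables have no part with exactly one chord, so `c = 0` for the projection of a diagram with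
at least two chords. The diagram with a single chord is itself primitive, with `p = X` and `F = N`.

The projection comes from the operator `ψ`, multiplication after comultiplication (`adams`). It is
an algebra map, and it acts on a product of `k` nonempty diagrams as `2^k` modulo products of more
factors. A bound on the number of ends makes this filtration finite, so elementary linear algebra
gives a 2-eigenspace complementary to the products of at least two factors. This eigenspace, taken
in positive degree, consists of the primitives, since `ψ ⊗ ψ` has no eigenvalue 2 on tensors with at
least two factors.

The universal polynomial exists by induction on the number of factors. Exchanging neighbouring
factors costs only shorter terms, so the factors can be sorted into cycles, and each cycle yields a
central element `C_k`. -/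

/-- The arc diagram obtained by permuting the ends of an arc diagram. -/
def ArcDiagram.ofPerm (D : ArcDiagram) (w : List ℕ) (h : D.word.Perm w) : ArcDiagram :=
  ⟨w, fun a ha => by rw [← h.count_eq]; exact D.count_eq_two a (h.mem_iff.2 ha)⟩

theorem close_eq_of_append_comm (u v : List ℕ) (D D' : ArcDiagram) (h : D.word = u ++ v)
    (h' : D'.word = v ++ u) : D.close = D'.close := by
  induction u generalizing v D with
  | nil => exact close_eq_of_word (by simp [h, h'])
  | cons a u ih =>
    have hp : D.word.Perm (u ++ (v ++ [a])) := by
      rw [h, ← List.append_assoc]; exact (List.perm_append_singleton a (u ++ v)).symm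
    rw [close_eq_of_step (.rotate D (D.ofPerm _ hp) a (u ++ v) h (by simp [ArcDiagram.ofPerm]))]
    exact ih (v ++ [a]) _ rfl (by simp [h'])

theorem close_eq_of_map (f : ℕ → ℕ) (D D' : ArcDiagram)
    (hf : ∀ a ∈ D.word, ∀ b ∈ D.word, f a = f b → a = b)
    (h : D'.word = D.word.map f) : D.close = D'.close := by
  classical
  -- A closure step needs a globally injective renaming; names outside the word are shifted by `M`,
  -- which exceeds every value of `f` on the word.
  let M := ∑ a ∈ D.word.toFinset, (f a + 1)
  have hM : ∀ a ∈ D.word, f a < M := fun a ha =>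
    Nat.lt_of_succ_le (Finset.single_le_sum (f := fun a => f a + 1) (fun _ _ => Nat.zero_le _)
      (List.mem_toFinset.2 ha))
  refine close_eq_of_step (.rename D D' (fun a => if a ∈ D.word then f a else a + M) ?_ ?_)
  · intro a b hab
    by_cases ha : a ∈ D.word <;> by_cases hb : b ∈ D.word <;> simp only [ha, hb, if_true, if_false] at hab
    · exact hf a ha b hb hab
    · have := hM a ha; omega
    · have := hM b hb; omega
    · omega
  · rw [h]
    exact List.map_congr_left fun a ha => by simp [ha]

/-- The concatenation of two arc diagrams. -/
def ArcDiagram.cat (D E : ArcDiagram) : ArcDiagram where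
  word := D.word.map (2 * ·) ++ E.word.map (2 * · + 1)
  count_eq_two a ha := by
    rw [List.count_append]
    rcases List.mem_append.1 ha with ha | ha <;> obtain ⟨x, hx, rfl⟩ := List.mem_map.1 ha
    · have h2 : List.count (2 * x) (E.word.map (2 * · + 1)) = 0 := by
        rw [List.count_eq_zero]; simp; omega
      rw [h2, List.count_map_of_injective (f := (2 * ·)) _ (fun a b h => by simpa using h) x,
        D.count_eq_two x hx]
    · have h2 : List.count (2 * x + 1) (D.word.map (2 * ·)) = 0 := by
        rw [List.count_eq_zero]; simp; omega
      rw [h2, List.count_map_of_injective (f := (2 * · + 1)) _ (fun a b h => by simpa using h) x,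
        E.count_eq_two x hx]

/-- The two images are automatically disjoint: a common letter would occur four times in `K`.
Commutativity, associativity and the unit law are all checked by choosing `f` and `g` here. -/
theorem close_cat (D E K : ArcDiagram) (f g : ℕ → ℕ)
    (hf : ∀ a ∈ D.word, ∀ b ∈ D.word, f a = f b → a = b)
    (hg : ∀ a ∈ E.word, ∀ b ∈ E.word, g a = g b → a = b)
    (h : K.word = D.word.map f ++ E.word.map g) : (D.cat E).close = K.close := by
  have hfg : ∀ a ∈ D.word, ∀ b ∈ E.word, f a ≠ g b := by
    intro a ha b hb hab
    have h1 := K.count_eq_two (f a) (by rw [h]; simp; left; exact ⟨a, ha, rfl⟩)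
    rw [h, List.count_append] at h1
    have h2 := List.count_le_count_map (f := f) (l := D.word) (x := a)
    have h3 := List.count_le_count_map (f := g) (l := E.word) (x := b)
    rw [D.count_eq_two a ha] at h2
    rw [E.count_eq_two b hb, ← hab] at h3
    omega
  refine close_eq_of_map (fun n => if n % 2 = 0 then f (n / 2) else g (n / 2)) _ _ ?_ ?_
  · intro a ha b hb hab
    simp only [ArcDiagram.cat, List.mem_append, List.mem_map] at ha hb
    have o : ∀ x : ℕ, (2 * x + 1) / 2 = x := fun x => by omega
    rcases ha with ⟨x, hx, rfl⟩ | ⟨x, hx, rfl⟩ <;> rcases hb with ⟨y, hy, rfl⟩ | ⟨y, hy, rfl⟩ <;>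
      simp [o, Nat.add_mod] at hab ⊢
    · exact hf x hx y hy hab
    · exact absurd hab (hfg x hx y hy)
    · exact absurd hab.symm (hfg y hy x hx)
    · exact hg x hx y hy hab
  · have o : ∀ x : ℕ, (2 * x + 1) / 2 = x := fun x => by omega
    simp [ArcDiagram.cat, h, Function.comp_def, o, Nat.add_mod]

theorem close_cat_comm (D E : ArcDiagram) : (D.cat E).close = (E.cat D).close := by
  have hp : (E.cat D).word.Perm (D.word.map (2 * · + 1) ++ E.word.map (2 * ·)) :=
    List.perm_append_comm
  rw [close_eq_of_append_comm _ _ (E.cat D) ((E.cat D).ofPerm _ hp) rfl rfl]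
  exact close_cat D E _ (2 * · + 1) (2 * ·) (by intros; omega) (by intros; omega) rfl

/-- The class of a double occurrence word; it is zero for all other words. -/
def clsWord (w : List ℕ) : ChordSpace :=
  open Classical in
  if h : ∀ a ∈ w, w.count a = 2 then (ArcDiagram.mk w h).close.cls else 0

theorem clsWord_word (D : ArcDiagram) : clsWord D.word = D.close.cls := by
  rw [clsWord, dif_pos D.count_eq_two]

/-- The default value 0 is harmless: the four words are permutations of each other, so all of them
are double occurrence words or none is. -/
theorem clsWord_four (u v w : List ℕ) (a b : ℕ) :
    (clsWord (u ++ [a, b] ++ v ++ [b] ++ w) - clsWord (u ++ [b, a] ++ v ++ [b] ++ w)) +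
    (clsWord (u ++ [b] ++ v ++ [a, b] ++ w) - clsWord (u ++ [b] ++ v ++ [b, a] ++ w)) = 0 := by
  have p2 : (u ++ [a, b] ++ v ++ [b] ++ w).Perm (u ++ [b, a] ++ v ++ [b] ++ w) := by
    simp only [List.append_assoc]
    exact List.Perm.append_left _ (List.Perm.swap _ _ _)
  have p34 : (u ++ [b] ++ v ++ [a, b] ++ w).Perm (u ++ [b] ++ v ++ [b, a] ++ w) := by
    simp only [List.append_assoc]
    exact List.Perm.append_left _ <| List.Perm.append_left _ <| List.Perm.append_left _
      (List.Perm.swap _ _ _)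
  have p3 : (u ++ [a, b] ++ v ++ [b] ++ w).Perm (u ++ [b] ++ v ++ [a, b] ++ w) := by
    rw [List.perm_iff_count]; intro x; simp only [List.count_append, List.count_cons]; omega
  by_cases h : ∀ x ∈ u ++ [a, b] ++ v ++ [b] ++ w, (u ++ [a, b] ++ v ++ [b] ++ w).count x = 2
  · let D : ArcDiagram := ⟨_, h⟩
    have := cls_four (D₁ := D) (D₂ := D.ofPerm _ p2) (D₃ := D.ofPerm _ p3)
      (D₄ := D.ofPerm _ (p3.trans p34)) u v w a b rfl rfl rfl rfl
    simp only [← clsWord_word] at this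
    exact this
  · have key : ∀ w', (u ++ [a, b] ++ v ++ [b] ++ w).Perm w' → clsWord w' = 0 := by
      intro w' hw
      rw [clsWord, dif_neg]
      intro h'
      exact h fun x hx => by rw [hw.count_eq]; exact h' x (hw.mem_iff.1 hx)
    rw [key _ (.refl _), key _ p2, key _ p3, key _ (p3.trans p34)]; simp

/-- An end of an arc passes through an arc diagram. -/
theorem clsWord_pass (E : ArcDiagram) (p q : List ℕ) (a : ℕ) :
    clsWord (p ++ a :: E.word ++ q) = clsWord (p ++ E.word ++ a :: q) := by
  set L := E.word with hL
  -- The end `a` standing after the first `i` letters of `E`.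
  let f : ℕ → ChordSpace := fun i => clsWord (p ++ L.take i ++ [a] ++ L.drop i ++ q)
  -- The four-term relation says that the jumps of `a` over the two ends of one chord of `E` cancel.
  have key : ∀ i j : ℕ, i < j → ∀ hj : j < L.length, ∀ hi : i < L.length, L[i] = L[j] →
      (f i - f (i + 1)) + (f j - f (j + 1)) = 0 := by
    intro i j hij hj hi hb
    have e : L = L.take i ++ [L[i]] ++ (L.drop (i + 1)).take (j - (i + 1)) ++ [L[i]]
        ++ L.drop (j + 1) := by
      have e1 : (L.drop (i + 1)).drop (j - (i + 1)) = L.drop j := by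
        rw [List.drop_drop]; congr 1; omega
      have e2 : L.drop j = [L[i]] ++ L.drop (j + 1) := by
        rw [hb]; simp
      have e3 : L.drop i = [L[i]] ++ L.drop (i + 1) := by simp
      conv_lhs => rw [← List.take_append_drop i L, e3,
        ← List.take_append_drop (j - (i + 1)) (L.drop (i + 1)), e1, e2]
      simp only [List.append_assoc]
    have hl1 : (L.take i).length = i := by simp; omega
    have hl2 : ((L.drop (i + 1)).take (j - (i + 1))).length = j - (i + 1) := by simp; omega
    generalize L.take i = W₁ at e hl1
    generalize (L.drop (i + 1)).take (j - (i + 1)) = W₂ at e hl2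
    generalize L.drop (j + 1) = W₃ at e
    generalize L[i] = b at e
    have t : ∀ X Y : List ℕ, L = X ++ Y → f X.length = clsWord (p ++ X ++ [a] ++ Y ++ q) := by
      intro X Y h
      simp only [f, h, List.take_left, List.drop_left]
    have t1 := t W₁ ([b] ++ W₂ ++ [b] ++ W₃) (by rw [e]; simp)
    have t2 := t (W₁ ++ [b]) (W₂ ++ [b] ++ W₃) (by rw [e]; simp)
    have t3 := t (W₁ ++ [b] ++ W₂) ([b] ++ W₃) (by rw [e]; simp)
    have t4 := t (W₁ ++ [b] ++ W₂ ++ [b]) W₃ (by rw [e])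
    have l3 : (W₁ ++ [b] ++ W₂).length = j := by simp; omega
    rw [l3] at t3
    rw [List.length_append, l3] at t4
    rw [List.length_append] at t2
    rw [hl1] at t1 t2
    simp only [List.length_singleton] at t2 t4
    rw [t1, t2, t3, t4]
    simpa using clsWord_four (p ++ W₁) W₂ (W₃ ++ q) a b
  have key' : ∀ i : Fin L.length, (f i - f (i + 1)) + (f (E.perm i) - f (E.perm i + 1)) = 0 := by
    intro i
    have h := (E.other_eq_iff i (E.perm i)).1 rfl
    rcases lt_or_gt_of_ne h.1 with h1 | h1
    · rw [add_comm]; exact key _ _ h1 i.2 (E.perm i).2 h.2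
    · exact key _ _ h1 (E.perm i).2 i.2 h.2.symm
  -- The total change telescopes into the sum of all jumps. Pairing every position with its partner
  -- counts each jump twice, hence the division by 2.
  have hs : f 0 - f L.length = 0 := by
    rw [← Finset.sum_range_sub' f, Finset.sum_range]
    have h2 := Equiv.sum_comp E.perm (fun i : Fin L.length => f i - f (i + 1))
    have h3 : ∑ i : Fin L.length, ((f i - f (i + 1)) + (f (E.perm i) - f (E.perm i + 1))) = 0 :=
      Finset.sum_eq_zero fun i _ => key' i
    rw [Finset.sum_add_distrib, h2, ← two_smul ℂ] at h3
    exact (smul_eq_zero.1 h3).resolve_left two_ne_zero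
  have := sub_eq_zero.1 hs
  simpa [f] using this

theorem cls_cat_of_word (D E K : ArcDiagram) (f g : ℕ → ℕ)
    (hf : Function.Injective f) (hg : Function.Injective g)
    (h : K.word = D.word.map f ++ E.word.map g) : (D.cat E).close.cls = K.close.cls := by
  rw [close_cat D E K f g (fun a _ b _ h => hf h) (fun a _ b _ h => hg h) h]

theorem close_cat_assoc (D E K : ArcDiagram) :
    ((D.cat E).cat K).close = (D.cat (E.cat K)).close := by
  refine close_cat _ K _ (fun n => if n % 2 = 0 then n else 2 * n - 1) (4 * · + 3) ?_ ?_ ?_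
  · intro a _ b _ hab
    split_ifs at hab <;> omega
  · intros; omega
  · have e : ∀ x : ℕ, 2 * (2 * x + 1) - 1 = 2 * (2 * x) + 1 := fun x => by omega
    have e' : ∀ x : ℕ, 2 * (2 * x + 1) + 1 = 4 * x + 3 := fun x => by omega
    simp [ArcDiagram.cat, Function.comp_def, Nat.add_mod, e, e']

/-- The product must not depend on where the circle of `E` is cut. The first end of `E` is pulled
leftwards through `D` by `clsWord_pass`, and then carried around the whole circle to the right end.
-/
theorem cls_cat_congr (D : ArcDiagram) {E E' : ArcDiagram} (h : ClosureStep E E') :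
    (D.cat E).close.cls = (D.cat E').close.cls := by
  cases h with
  | rename f hf h =>
    exact congrArg _ (close_cat D E _ (2 * ·) (2 * f · + 1) (by intros; omega)
      (fun a _ b _ hab => hf (by omega)) (by simp [ArcDiagram.cat, h, Function.comp_def]))
  | rotate a u h h' =>
    let W : ArcDiagram := ⟨D.word.map (2 * ·), fun x hx => by
      have := (D.cat E).count_eq_two x (List.mem_append_left _ hx)
      obtain ⟨y, hy, rfl⟩ := List.mem_map.1 hx
      rw [List.count_map_of_injective (f := (2 * ·)) _ (fun a b h => by simpa using h) y,
        D.count_eq_two y hy]⟩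
    have h1 := clsWord_pass W [] (u.map (2 * · + 1)) (2 * a + 1)
    have e1 : (D.cat E).word = [] ++ W.word ++ (2 * a + 1) :: u.map (2 * · + 1) := by
      simp [ArcDiagram.cat, h, W]
    have e2 : (D.cat E').word = (W.word ++ u.map (2 * · + 1)) ++ [2 * a + 1] := by
      simp [ArcDiagram.cat, h', W]
    rw [← clsWord_word, e1, ← h1]
    let K : ArcDiagram := (D.cat E').ofPerm ([2 * a + 1] ++ (W.word ++ u.map (2 * · + 1)))
      (by rw [e2]; exact List.perm_append_comm)
    rw [← close_eq_of_append_comm _ _ K (D.cat E') rfl e2, ← clsWord_word]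
    rfl

theorem lin_ext {V : Type*} [AddCommGroup V] [Module ℂ V] {f g : ChordSpace →ₗ[ℂ] V}
    (h : ∀ D : ArcDiagram, f D.close.cls = g D.close.cls) : f = g := by
  apply Submodule.linearMap_qext
  apply Finsupp.lhom_ext'
  intro B
  apply LinearMap.ext_ring
  induction B using Quot.ind with
  | _ D => exact h D

/-- A function of arc diagrams which satisfies the four-term relations and is invariant under the
closure steps defines a linear map on chord diagrams modulo the four-term relations. -/
theorem exists_lift {V : Type*} [AddCommGroup V] [Module ℂ V] (f : ArcDiagram → V)
    (h : ∀ D E, ClosureStep D E → f D = f E)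
    (h4 : ∀ (D₁ D₂ D₃ D₄ : ArcDiagram) (u v w : List ℕ) (a b : ℕ),
      D₁.word = u ++ [a, b] ++ v ++ [b] ++ w → D₂.word = u ++ [b, a] ++ v ++ [b] ++ w →
      D₃.word = u ++ [b] ++ v ++ [a, b] ++ w → D₄.word = u ++ [b] ++ v ++ [b, a] ++ w →
      (f D₁ - f D₂) + (f D₃ - f D₄) = 0) :
    ∃ F : ChordSpace →ₗ[ℂ] V, ∀ D : ArcDiagram, F D.close.cls = f D := by
  let g : ChordDiagram → V := Quot.lift f h
  have hg : ∀ D : ArcDiagram, g D.close = f D := fun D => rfl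
  have hker : fourTerm ≤ LinearMap.ker (Finsupp.linearCombination ℂ g) := by
    refine Submodule.span_le.mpr ?_
    rintro z ⟨D₁, D₂, D₃, D₄, u, v, w, a, b, h₁, h₂, h₃, h₄, rfl⟩
    have := h4 D₁ D₂ D₃ D₄ u v w a b h₁ h₂ h₃ h₄
    simpa [hg] using this
  refine ⟨fourTerm.liftQ (Finsupp.linearCombination ℂ g) hker, fun D => ?_⟩
  refine (Submodule.liftQ_apply _ _ _).trans ?_
  rw [Finsupp.linearCombination_single, one_smul, hg]

theorem exists_catR (D : ArcDiagram) :
    ∃ F : ChordSpace →ₗ[ℂ] ChordSpace, ∀ E : ArcDiagram, F E.close.cls = (D.cat E).close.cls := by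
  refine exists_lift _ (fun E E' h => cls_cat_congr D h) ?_
  intro D₁ D₂ D₃ D₄ u v w a b h₁ h₂ h₃ h₄
  refine cls_four (D.word.map (2 * ·) ++ u.map (2 * · + 1)) (v.map (2 * · + 1))
    (w.map (2 * · + 1)) (2 * a + 1) (2 * b + 1) ?_ ?_ ?_ ?_ <;>
  simp [ArcDiagram.cat, h₁, h₂, h₃, h₄]

/-- Compatibility in the first variable is deduced from that in the second by commutativity. -/
theorem exists_mul : ∃ F : ChordSpace →ₗ[ℂ] ChordSpace →ₗ[ℂ] ChordSpace,
    ∀ D E : ArcDiagram, F D.close.cls E.close.cls = (D.cat E).close.cls := by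
  choose R hR using exists_catR
  have hcomm : ∀ D E : ArcDiagram, R D E.close.cls = R E D.close.cls := fun D E => by
    rw [hR, hR, close_cat_comm]
  obtain ⟨F, hF⟩ := exists_lift R (fun D D' h => lin_ext fun E => by
    rw [hcomm, hcomm D', close_eq_of_step h]) (by
    intro D₁ D₂ D₃ D₄ u v w a b h₁ h₂ h₃ h₄
    refine lin_ext fun E => ?_
    simp only [LinearMap.add_apply, LinearMap.sub_apply, hcomm _ E, ← map_sub, ← map_add,
      cls_four u v w a b h₁ h₂ h₃ h₄, map_zero, LinearMap.zero_apply])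
  exact ⟨F, fun D E => by rw [hF, hR]⟩

/-- The product of chord diagrams modulo the four-term relations. -/
def mulMap : ChordSpace →ₗ[ℂ] ChordSpace →ₗ[ℂ] ChordSpace := exists_mul.choose

theorem mulMap_cls (D E : ArcDiagram) :
    mulMap D.close.cls E.close.cls = (D.cat E).close.cls := exists_mul.choose_spec D E

theorem mulMap_comm (x y : ChordSpace) : mulMap x y = mulMap y x := by
  have : mulMap = mulMap.flip := lin_ext fun D => lin_ext fun E => by
    rw [LinearMap.flip_apply, mulMap_cls, mulMap_cls, close_cat_comm]
  rw [← LinearMap.flip_apply, ← this]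

theorem mulMap_unit (x : ChordSpace) : mulMap unit x = x := by
  have : mulMap unit = LinearMap.id := lin_ext fun D => by
    rw [unit, mulMap_cls, cls_cat_of_word _ _ D id id Function.injective_id Function.injective_id]
    · rfl
    · simp [ArcDiagram.empty]
  rw [this]; rfl

@[elab_as_elim]
theorem cls_induction {p : ChordSpace → Prop} (x : ChordSpace)
    (cls : ∀ D : ArcDiagram, p D.close.cls) (zero : p 0)
    (add : ∀ x y, p x → p y → p (x + y)) (smul : ∀ (c : ℂ) x, p x → p (c • x)) : p x := by
  obtain ⟨z, rfl⟩ := Submodule.mkQ_surjective _ x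
  induction z using Finsupp.induction_linear with
  | zero => simpa using zero
  | add f g hf hg => rw [map_add]; exact add _ _ hf hg
  | single B c =>
    induction B using Quot.ind with
    | _ D =>
      have h := smul c _ (cls D)
      rwa [ChordDiagram.cls, ← map_smul, Finsupp.smul_single, smul_eq_mul, mul_one] at h

theorem mulMap_assoc (x y z : ChordSpace) :
    mulMap (mulMap x y) z = mulMap x (mulMap y z) := by
  induction x using cls_induction with
  | zero => simp
  | add a b ha hb => simp only [map_add, LinearMap.add_apply, ha, hb]
  | smul c a ha => simp only [map_smul, LinearMap.smul_apply, ha]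
  | cls D =>
  induction y using cls_induction with
  | zero => simp
  | add a b ha hb => simp only [map_add, LinearMap.add_apply, ha, hb]
  | smul c a ha => simp only [map_smul, LinearMap.smul_apply, ha]
  | cls E =>
  induction z using cls_induction with
  | zero => simp
  | add a b ha hb => simp only [map_add, ha, hb]
  | smul c a ha => simp only [map_smul, ha]
  | cls K =>
  simp only [mulMap_cls]
  rw [close_cat_assoc]

instance : CommRing ChordSpace :=
  { (inferInstance : AddCommGroup ChordSpace) with
    mul := fun x y => mulMap x y
    one := unit
    mul_assoc := mulMap_assoc
    mul_comm := mulMap_comm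
    one_mul := mulMap_unit
    mul_one := fun x => (mulMap_comm x unit).trans (mulMap_unit x)
    left_distrib := fun x y z => (mulMap x).map_add y z
    right_distrib := fun x y z => mulMap.map_add₂ x y z
    zero_mul := fun x => mulMap.map_zero₂ x
    mul_zero := fun x => (mulMap x).map_zero }

instance : Algebra ℂ ChordSpace :=
  Algebra.ofModule (fun c x y => mulMap.map_smul₂ c x y) (fun c x y => (mulMap x).map_smul c y)

theorem unit_eq_one : unit = 1 := rfl

theorem cls_mul_cls (D E : ArcDiagram) : D.close.cls * E.close.cls = (D.cat E).close.cls :=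
  mulMap_cls D E

theorem cls_eq_one (D : ArcDiagram) (h : D.word = []) : D.close.cls = 1 := by
  rw [← unit_eq_one, unit, close_eq_of_word (D' := ArcDiagram.empty)]
  simp [h, ArcDiagram.empty]


/-! ### The bialgebra of chord diagrams -/

theorem comul_cls (D : ArcDiagram) : comul D.close.cls = D.split := by
  refine (Submodule.liftQ_apply _ _ _).trans ?_
  rw [Finsupp.linearCombination_single, one_smul]
  rfl

theorem cls_restrict_cat (D E : ArcDiagram) (T T₁ T₂ : Finset ℕ)
    (h₁ : ∀ x ∈ D.word, 2 * x ∈ T ↔ x ∈ T₁) (h₂ : ∀ x ∈ E.word, 2 * x + 1 ∈ T ↔ x ∈ T₂) :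
    ((D.cat E).restrict T).close.cls = (D.restrict T₁).close.cls * (E.restrict T₂).close.cls := by
  rw [cls_mul_cls]
  congr 1
  refine close_eq_of_word ?_
  simp only [ArcDiagram.restrict, ArcDiagram.cat, List.filter_append, List.filter_map]
  congr 2
  · exact List.filter_congr fun x hx => by simp [h₁ x hx]
  · exact List.filter_congr fun x hx => by simp [h₂ x hx]

/-- A subset of the chords of a concatenation is a pair of subsets; parity of the names tells the
factors apart. -/
theorem comul_cls_mul_cls (D E : ArcDiagram) :
    comul (D.close.cls * E.close.cls) = comul D.close.cls * comul E.close.cls := by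
  rw [cls_mul_cls, comul_cls, comul_cls, comul_cls]
  unfold ArcDiagram.split
  rw [Finset.sum_mul_sum, ← Finset.sum_product']
  have hL : (D.cat E).word.toFinset =
      D.word.toFinset.image (2 * ·) ∪ E.word.toFinset.image (2 * · + 1) := by
    ext; simp [ArcDiagram.cat]
  refine Finset.sum_nbij'
    (fun S => (D.word.toFinset.filter (2 * · ∈ S), E.word.toFinset.filter (2 * · + 1 ∈ S)))
    (fun p => p.1.image (2 * ·) ∪ p.2.image (2 * · + 1)) ?_ ?_ ?_ ?_ ?_
  · intro S _
    simp
  · rintro ⟨S, T⟩ h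
    rw [Finset.mem_product, Finset.mem_powerset, Finset.mem_powerset] at h
    rw [Finset.mem_powerset, hL]
    exact Finset.union_subset_union (Finset.image_subset_image h.1) (Finset.image_subset_image h.2)
  · intro S hS
    rw [Finset.mem_powerset, hL] at hS
    ext x
    constructor
    · intro hx
      simp only [Finset.mem_union, Finset.mem_image, Finset.mem_filter] at hx
      rcases hx with ⟨y, ⟨_, hy⟩, rfl⟩ | ⟨y, ⟨_, hy⟩, rfl⟩ <;> exact hy
    · intro hx
      have := hS hx
      simp only [Finset.mem_union, Finset.mem_image, Finset.mem_filter] at this ⊢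
      rcases this with ⟨y, hy, rfl⟩ | ⟨y, hy, rfl⟩
      · exact Or.inl ⟨y, ⟨hy, hx⟩, rfl⟩
      · exact Or.inr ⟨y, ⟨hy, hx⟩, rfl⟩
  · rintro ⟨S, T⟩ h
    rw [Finset.mem_product, Finset.mem_powerset, Finset.mem_powerset] at h
    have o : ∀ x y : ℕ, ¬ 2 * x + 1 = 2 * y := fun x y => by omega
    have o' : ∀ x y : ℕ, ¬ 2 * x = 2 * y + 1 := fun x y => by omega
    refine Prod.ext ?_ ?_
    · ext x; simp [o]; exact fun hx => List.mem_toFinset.1 (h.1 hx)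
    · ext x; simp [o']; exact fun hx => List.mem_toFinset.1 (h.2 hx)
  · intro S _
    rw [Algebra.TensorProduct.tmul_mul_tmul]
    congr 1
    · refine cls_restrict_cat _ _ _ _ _ ?_ ?_ <;> intro x hx <;> simp [hx]
    · refine cls_restrict_cat _ _ _ _ _ ?_ ?_ <;> intro x hx <;> simp [hx, ArcDiagram.cat]

theorem comul_mul (x y : ChordSpace) : comul (x * y) = comul x * comul y := by
  induction x using cls_induction with
  | zero => simp
  | add a b ha hb => simp only [add_mul, map_add, ha, hb]
  | smul c a ha => simp only [smul_mul_assoc, map_smul, ha]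
  | cls D =>
  induction y using cls_induction with
  | zero => simp
  | add a b ha hb => simp only [mul_add, map_add, ha, hb]
  | smul c a ha => simp only [mul_smul_comm, map_smul, ha]
  | cls E => exact comul_cls_mul_cls D E

theorem comul_one : comul 1 = 1 := by
  rw [← unit_eq_one, unit, comul_cls, ArcDiagram.split]
  simp only [ArcDiagram.empty, List.toFinset_nil, Finset.powerset_empty, Finset.sum_singleton]
  rw [cls_eq_one, cls_eq_one, Algebra.TensorProduct.one_def] <;> simp [ArcDiagram.restrict]

theorem toFinset_word_restrict (D : ArcDiagram) {S : Finset ℕ} (hS : S ⊆ D.word.toFinset) :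
    (D.restrict S).word.toFinset = S := by
  ext x
  simp only [ArcDiagram.restrict, List.mem_toFinset, List.mem_filter, decide_eq_true_eq]
  exact ⟨fun h => h.2, fun h => ⟨List.mem_toFinset.1 (hS h), h⟩⟩

theorem length_word_eq (D : ArcDiagram) : D.word.length = 2 * D.word.toFinset.card := by
  rw [← List.sum_toFinset_count_eq_length, Finset.sum_congr rfl fun a ha =>
    D.count_eq_two a (List.mem_toFinset.1 ha), Finset.sum_const, smul_eq_mul, mul_comm]

theorem length_word_restrict (D : ArcDiagram) {S : Finset ℕ} (hS : S ⊆ D.word.toFinset) :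
    (D.restrict S).word.length = 2 * S.card := by
  rw [length_word_eq, toFinset_word_restrict D hS]

theorem comul_restrict (D : ArcDiagram) (S : Finset ℕ) (hS : S ⊆ D.word.toFinset) :
    comul (D.restrict S).close.cls = ∑ A ∈ S.powerset,
      (D.restrict A).close.cls ⊗ₜ[ℂ] (D.restrict (S \ A)).close.cls := by
  rw [comul_cls, ArcDiagram.split]
  rw [toFinset_word_restrict D hS]
  have key : ∀ A ⊆ S, ((D.restrict S).restrict A).close = (D.restrict A).close := by
    intro A hA
    refine close_eq_of_word ?_
    simp only [ArcDiagram.restrict, List.filter_filter]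
    refine List.filter_congr fun x _ => ?_
    by_cases hx : x ∈ A
    · simp [hx, hA hx]
    · simp [hx]
  refine Finset.sum_congr rfl fun A hA => ?_
  rw [key A (Finset.mem_powerset.1 hA), key _ Finset.sdiff_subset]

/-- The convolution square of the identity. -/
def adams : ChordSpace →ₗ[ℂ] ChordSpace := LinearMap.mul' ℂ ChordSpace ∘ₗ comul

theorem adams_mul (x y : ChordSpace) : adams (x * y) = adams x * adams y := by
  have h : ∀ z : ChordSpace ⊗[ℂ] ChordSpace,
    LinearMap.mul' ℂ ChordSpace z = Algebra.TensorProduct.lmul' ℂ z := fun z => rfl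
  simp only [adams, LinearMap.comp_apply, comul_mul, h, map_mul]

theorem adams_one : adams 1 = 1 := by
  rw [adams, LinearMap.comp_apply, comul_one, Algebra.TensorProduct.one_def]
  simp

/-- Both sides sum over partitions of the chords into four blocks `A`, `S \ A`, `B` and the rest.
They differ by exchanging the two middle blocks, which is the bijection `(S, A, B) ↦ (A ∪ B, A, S \
A)`. -/
theorem comul_adams (x : ChordSpace) :
    comul (adams x) = TensorProduct.map adams adams (comul x) := by
  suffices comul ∘ₗ adams = TensorProduct.map adams adams ∘ₗ comul from LinearMap.congr_fun this x
  refine lin_ext fun D => ?_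
  set L := D.word.toFinset with hL
  let c : Finset ℕ → ChordSpace := fun S => (D.restrict S).close.cls
  have hc : ∀ S ⊆ L, comul (c S) = ∑ A ∈ S.powerset, c A ⊗ₜ[ℂ] c (S \ A) := comul_restrict D
  have hD : comul D.close.cls = ∑ S ∈ L.powerset, c S ⊗ₜ[ℂ] c (L \ S) := comul_cls D
  have hmap : ∀ S ⊆ L, adams (c S) = ∑ A ∈ S.powerset, c A * c (S \ A) := by
    intro S hS
    simp [adams, hc S hS]
  have hl : (comul ∘ₗ adams) D.close.cls = ∑ s ∈ L.powerset.sigma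
      (fun S => S.powerset ×ˢ (L \ S).powerset),
      (c s.2.1 * c s.2.2) ⊗ₜ[ℂ] (c (s.1 \ s.2.1) * c ((L \ s.1) \ s.2.2)) := by
    rw [Finset.sum_sigma, LinearMap.comp_apply]
    simp only [adams, LinearMap.comp_apply, hD, map_sum, LinearMap.mul'_apply, comul_mul]
    refine Finset.sum_congr rfl fun S hS => ?_
    rw [hc S (Finset.mem_powerset.1 hS), hc _ Finset.sdiff_subset, Finset.sum_mul_sum,
      Finset.sum_product]
    simp only [Algebra.TensorProduct.tmul_mul_tmul]
  have hr : (TensorProduct.map adams adams ∘ₗ comul) D.close.cls = ∑ s ∈ L.powerset.sigma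
      (fun S => S.powerset ×ˢ (L \ S).powerset),
      (c s.2.1 * c (s.1 \ s.2.1)) ⊗ₜ[ℂ] (c s.2.2 * c ((L \ s.1) \ s.2.2)) := by
    rw [Finset.sum_sigma, LinearMap.comp_apply]
    simp only [hD, map_sum, TensorProduct.map_tmul]
    refine Finset.sum_congr rfl fun S hS => ?_
    rw [hmap S (Finset.mem_powerset.1 hS), hmap _ Finset.sdiff_subset, TensorProduct.sum_tmul,
      Finset.sum_product]
    simp only [TensorProduct.tmul_sum]
  rw [hl, hr]
  refine Finset.sum_nbij' (fun s => ⟨s.2.1 ∪ s.2.2, s.2.1, s.1 \ s.2.1⟩)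
    (fun s => ⟨s.2.1 ∪ s.2.2, s.2.1, s.1 \ s.2.1⟩) ?_ ?_ ?_ ?_ ?_
  · rintro ⟨S, A, B⟩ h
    simp only [Finset.mem_sigma, Finset.mem_product, Finset.mem_powerset, Finset.subset_iff,
      Finset.mem_union, Finset.mem_sdiff] at h ⊢
    grind
  · rintro ⟨S, A, B⟩ h
    simp only [Finset.mem_sigma, Finset.mem_product, Finset.mem_powerset, Finset.subset_iff,
      Finset.mem_union, Finset.mem_sdiff] at h ⊢
    grind
  · rintro ⟨S, A, B⟩ h
    simp only [Finset.mem_sigma, Finset.mem_product, Finset.mem_powerset, Finset.subset_iff,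
      Finset.mem_sdiff] at h
    have e1 : A ∪ S \ A = S := by ext x; simp; grind
    have e2 : (A ∪ B) \ A = B := by ext x; simp; grind
    simp [e1, e2]
  · rintro ⟨S, A, B⟩ h
    simp only [Finset.mem_sigma, Finset.mem_product, Finset.mem_powerset, Finset.subset_iff,
      Finset.mem_sdiff] at h
    have e1 : A ∪ S \ A = S := by ext x; simp; grind
    have e2 : (A ∪ B) \ A = B := by ext x; simp; grind
    simp [e1, e2]
  · rintro ⟨S, A, B⟩ h
    simp only [Finset.mem_sigma, Finset.mem_product, Finset.mem_powerset, Finset.subset_iff,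
      Finset.mem_sdiff] at h
    have e2 : (A ∪ B) \ A = B := by ext x; simp; grind
    have e3 : (L \ (A ∪ B)) \ (S \ A) = (L \ S) \ B := by ext x; simp; grind
    simp only [e2, e3]


/-! ### The filtration by the number of factors -/

/-- `IsMonomial k n z`: `z` is the product of `k` nonempty diagrams with `n` ends altogether. -/
inductive IsMonomial : ℕ → ℕ → ChordSpace → Prop
  | one : IsMonomial 0 0 1
  | cons (D : ArcDiagram) (hD : D.word ≠ []) {k n : ℕ} {z : ChordSpace} (h : IsMonomial k n z) :
      IsMonomial (k + 1) (D.word.length + n) (D.close.cls * z)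

theorem IsMonomial.le {k n : ℕ} {z : ChordSpace} (h : IsMonomial k n z) : k ≤ n := by
  induction h with
  | one => exact le_rfl
  | cons D hD h ih =>
    have := List.length_pos_iff.2 hD
    omega

theorem IsMonomial.mul {k n l m : ℕ} {x y : ChordSpace} (hx : IsMonomial k n x)
    (hy : IsMonomial l m y) : IsMonomial (k + l) (n + m) (x * y) := by
  induction hx with
  | one => simpa using hy
  | cons D hD h ih => simpa only [mul_assoc, add_assoc, add_right_comm _ 1] using ih.cons D hD

theorem IsMonomial.of_diagram (D : ArcDiagram) (hD : D.word ≠ []) :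
    IsMonomial 1 D.word.length D.close.cls := by
  simpa using IsMonomial.one.cons D hD

theorem IsMonomial.exists_diagram {k n : ℕ} {z : ChordSpace} (h : IsMonomial k n z) :
    ∃ D : ArcDiagram, z = D.close.cls ∧ D.word.length = n := by
  induction h with
  | one => exact ⟨ArcDiagram.empty, rfl, rfl⟩
  | cons D hD h ih =>
    obtain ⟨E, rfl, rfl⟩ := ih
    exact ⟨D.cat E, cls_mul_cls D E, by simp [ArcDiagram.cat]⟩

/-- The span of the products of at least `k` nonempty diagrams with at most `n` ends. -/
def products (k n : ℕ) : Submodule ℂ ChordSpace :=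
  Submodule.span ℂ {z | ∃ l m, k ≤ l ∧ m ≤ n ∧ IsMonomial l m z}

theorem IsMonomial.mem {k n : ℕ} {z : ChordSpace} (h : IsMonomial k n z) : z ∈ products k n :=
  Submodule.subset_span ⟨k, n, le_rfl, le_rfl, h⟩

theorem products_mono {k n l m : ℕ} (hk : l ≤ k) (hn : n ≤ m) : products k n ≤ products l m :=
  Submodule.span_mono fun _ ⟨k', n', h, h', hz⟩ => ⟨k', n', hk.trans h, h'.trans hn, hz⟩

/-- A nonempty diagram has at least one end. This finiteness is the reason for carrying the bound
`n`. -/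
theorem products_eq_bot {k n : ℕ} (h : n < k) : products k n = ⊥ := by
  rw [products, Submodule.span_eq_bot]
  rintro z ⟨l, m, hl, hm, hz⟩
  have := hz.le
  omega

theorem mul_mem_products {k n l m : ℕ} {x y : ChordSpace} (hx : x ∈ products k n)
    (hy : y ∈ products l m) : x * y ∈ products (k + l) (n + m) := by
  have h := Submodule.mul_mem_mul hx hy
  rw [products, products, Submodule.span_mul_span] at h
  refine Submodule.span_mono ?_ h
  rintro _ ⟨a, ⟨k', n', h1, h2, ha⟩, b, ⟨l', m', h3, h4, hb⟩, rfl⟩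
  exact ⟨_, _, add_le_add h1 h3, add_le_add h2 h4, ha.mul hb⟩

/-- The span of the tensors of two products with at least `k` factors and at most `n` ends
altogether. -/
def tensorProducts (k n : ℕ) : Submodule ℂ (ChordSpace ⊗[ℂ] ChordSpace) :=
  Submodule.span ℂ {z | ∃ l m l' m' a b, k ≤ l + l' ∧ m + m' ≤ n ∧ IsMonomial l m a ∧
    IsMonomial l' m' b ∧ z = a ⊗ₜ[ℂ] b}

theorem tensorProducts_mono {k n l m : ℕ} (hk : l ≤ k) (hn : n ≤ m) :
    tensorProducts k n ≤ tensorProducts l m := by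
  refine Submodule.span_mono ?_
  rintro _ ⟨p, q, p', q', a, b, h, h', ha, hb, rfl⟩
  exact ⟨p, q, p', q', a, b, hk.trans h, h'.trans hn, ha, hb, rfl⟩

theorem tensorProducts_eq_bot {k n : ℕ} (h : n < k) : tensorProducts k n = ⊥ := by
  rw [tensorProducts, Submodule.span_eq_bot]
  rintro _ ⟨p, q, p', q', a, b, h1, h2, ha, hb, rfl⟩
  have := ha.le
  have := hb.le
  omega

theorem tmul_mem_tensorProducts {k n l m : ℕ} {x y : ChordSpace} (hx : x ∈ products k n)
    (hy : y ∈ products l m) : x ⊗ₜ[ℂ] y ∈ tensorProducts (k + l) (n + m) := by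
  have h := Submodule.apply_mem_map₂ (TensorProduct.mk ℂ ChordSpace ChordSpace) hx hy
  rw [products, products, Submodule.map₂_span_span] at h
  refine Submodule.span_mono ?_ h
  rintro _ ⟨a, ⟨k', n', h1, h2, ha⟩, b, ⟨l', m', h3, h4, hb⟩, rfl⟩
  exact ⟨_, _, _, _, a, b, add_le_add h1 h3, add_le_add h2 h4, ha, hb, rfl⟩

/-- The empty and the full subset give the two subtracted terms; every other splitting has two
nonempty parts. -/
theorem reduced_comul_mem (D : ArcDiagram) (hD : D.word ≠ []) :
    comul D.close.cls - (1 ⊗ₜ[ℂ] D.close.cls + D.close.cls ⊗ₜ[ℂ] 1) ∈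
      tensorProducts 2 D.word.length := by
  classical
  have h0 : (∅ : Finset ℕ) ∈ D.word.toFinset.powerset.erase D.word.toFinset := by
    simp [Ne.symm (List.toFinset_eq_empty_iff _ |>.not.2 hD)]
  have hfull : (D.restrict D.word.toFinset).close.cls = D.close.cls := by
    refine congrArg _ (close_eq_of_word ?_)
    simp only [ArcDiagram.restrict]
    exact List.filter_eq_self.2 fun x hx => by simpa using hx
  have hempty : (D.restrict ∅).close.cls = 1 := cls_eq_one _ (by simp [ArcDiagram.restrict])
  rw [comul_cls, ArcDiagram.split, ← Finset.add_sum_erase _ _ (Finset.mem_powerset_self _),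
    ← Finset.add_sum_erase _ _ h0]
  simp only [Finset.sdiff_self, Finset.sdiff_empty, hfull, hempty]
  have e : ∀ a b c : ChordSpace ⊗[ℂ] ChordSpace, a + (b + c) - (b + a) = c := fun a b c => by abel
  rw [e]
  refine Submodule.sum_mem _ fun S hS => ?_
  simp only [Finset.mem_erase, Finset.mem_powerset] at hS
  have key : ∀ T : Finset ℕ, T ⊆ D.word.toFinset → T ≠ ∅ → (D.restrict T).word ≠ [] := by
    intro T hT hT0 h
    obtain ⟨x, hx⟩ := Finset.nonempty_iff_ne_empty.2 hT0
    have : x ∈ (D.restrict T).word :=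
      List.mem_filter.2 ⟨List.mem_toFinset.1 (hT hx), by simpa using hx⟩
    simp [h] at this
  have hl : (D.restrict S).word.length + (D.restrict (D.word.toFinset \ S)).word.length =
      D.word.length := by
    simp only [ArcDiagram.restrict]
    rw [List.length_eq_length_filter_add (l := D.word) (· ∈ S)]
    congr 2
    exact List.filter_congr fun x hx => by simp [hx]
  rw [← hl]
  refine tmul_mem_tensorProducts (k := 1) (l := 1) (IsMonomial.of_diagram _ ?_).mem
    (IsMonomial.of_diagram _ ?_).mem
  · exact key S hS.2.2 hS.1
  · refine key _ Finset.sdiff_subset ?_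
    rw [Ne, Finset.sdiff_eq_empty_iff_subset]
    exact fun h => hS.2.1 (hS.2.2.antisymm h)

theorem adams_cls_sub_mem (D : ArcDiagram) (hD : D.word ≠ []) :
    adams D.close.cls - (2 : ℂ) • D.close.cls ∈ products 2 D.word.length := by
  have hle : tensorProducts 2 D.word.length ≤
      (products 2 D.word.length).comap (LinearMap.mul' ℂ ChordSpace) := by
    refine Submodule.span_le.2 ?_
    rintro _ ⟨p, q, p', q', a, b, h1, h2, ha, hb, rfl⟩
    exact Submodule.subset_span ⟨_, _, h1, h2, by simpa using ha.mul hb⟩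
  have h := hle (reduced_comul_mem D hD)
  simpa [adams, two_smul] using h

/-- `adams` is multiplicative and doubles each generator modulo products of two, so each factor
contributes a 2 to the leading coefficient. -/
theorem IsMonomial.adams_sub_mem {k n : ℕ} {z : ChordSpace} (h : IsMonomial k n z) :
    adams z - (2 : ℂ) ^ k • z ∈ products (k + 1) n := by
  induction h with
  | one => simp [adams_one]
  | @cons D hD k n z h ih =>
    have hz : adams z ∈ products k n := by
      have := Submodule.add_mem _ (products_mono (Nat.le_succ k) le_rfl ih)
        (Submodule.smul_mem _ ((2 : ℂ) ^ k) h.mem)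
      simpa using this
    have e : adams (D.close.cls * z) - (2 : ℂ) ^ (k + 1) • (D.close.cls * z) =
        (adams D.close.cls - (2 : ℂ) • D.close.cls) * adams z +
        (2 : ℂ) • (D.close.cls * (adams z - (2 : ℂ) ^ k • z)) := by
      rw [adams_mul]
      simp only [sub_mul, mul_sub, smul_sub, smul_mul_assoc, mul_smul_comm, smul_smul, pow_succ']
      abel
    rw [e]
    refine Submodule.add_mem _ ?_ (Submodule.smul_mem _ _ ?_)
    · have := mul_mem_products (adams_cls_sub_mem D hD) hz
      rwa [show 2 + k = k + 1 + 1 by ring] at this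
    · have := mul_mem_products (IsMonomial.of_diagram D hD).mem ih
      rwa [show 1 + (k + 1) = k + 1 + 1 by ring] at this

theorem IsMonomial.adams_mem {k n : ℕ} {z : ChordSpace} (h : IsMonomial k n z) :
    adams z ∈ products k n := by
  have := Submodule.add_mem _ (products_mono (Nat.le_succ k) le_rfl h.adams_sub_mem)
    (Submodule.smul_mem _ ((2 : ℂ) ^ k) h.mem)
  simpa using this

/-! ### Linear algebra of finite filtrations -/

/-- An operator which acts on the generators of the `k`-th term of a filtration as the
multiplication by `2 ^ k` modulo the next term. -/
theorem sub_two_pow_smul_mem {V : Type*} [AddCommGroup V] [Module ℂ V] (f : V →ₗ[ℂ] V)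
    (G : ℕ → Submodule ℂ V) (hG : Antitone G) {s : Set V} {k : ℕ}
    (hs : ∀ z ∈ s, ∃ l, k ≤ l ∧ z ∈ G l ∧ f z - (2 : ℂ) ^ l • z ∈ G (l + 1)) {x : V}
    (hx : x ∈ Submodule.span ℂ s) : f x - (2 : ℂ) ^ k • x ∈ G (k + 1) := by
  suffices Submodule.span ℂ s ≤ (G (k + 1)).comap (f - (2 : ℂ) ^ k • LinearMap.id) from this hx
  refine Submodule.span_le.2 fun z hz => ?_
  obtain ⟨l, hl, hzl, hfz⟩ := hs z hz
  rcases hl.eq_or_lt with rfl | hl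
  · exact hfz
  · have h1 := hG (Nat.succ_le_succ hl.le) hfz
    have h2 := hG (Nat.succ_le_of_lt hl) hzl
    have := Submodule.add_mem _ h1 (Submodule.smul_mem _ ((2 : ℂ) ^ l - (2 : ℂ) ^ k) h2)
    rw [sub_smul, sub_add_sub_cancel] at this
    exact this

/-- An eigenvector for 2 lying in `G k` satisfies `(2 - 2^k) x ∈ G (k + 1)`. For `k ≥ 2` the
coefficient is nonzero, so `x` climbs the filtration until it vanishes. -/
theorem eq_zero_of_filtration {V : Type*} [AddCommGroup V] [Module ℂ V] (f : V →ₗ[ℂ] V)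
    (G : ℕ → Submodule ℂ V) (hf : ∀ k, ∀ x ∈ G k, f x - (2 : ℂ) ^ k • x ∈ G (k + 1)) {n : ℕ}
    (hn : ∀ k, n < k → G k = ⊥) {x : V} (hx : x ∈ G 2) (h : f x = (2 : ℂ) • x) : x = 0 := by
  have key : ∀ k, x ∈ G (k + 2) := by
    intro k
    induction k with
    | zero => exact hx
    | succ k ih =>
      have h1 := hf _ x ih
      rw [h, ← sub_smul] at h1
      refine (Submodule.smul_mem_iff _ ?_).1 h1
      rw [pow_succ', ← mul_one_sub, mul_ne_zero_iff, sub_ne_zero]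
      refine ⟨two_ne_zero, fun h2 => ?_⟩
      have h3 : (1 : ℕ) = 2 ^ (k + 1) := by exact_mod_cast h2
      have := Nat.one_lt_two_pow (Nat.succ_ne_zero k)
      omega
  have := key n
  rwa [hn _ (by omega), Submodule.mem_bot] at this

/-- The operator `f - 2` is inverted on `G 2` by successive approximation: dividing by `2^k - 2`
solves the equation modulo the next term, and the error is treated in the same way. -/
theorem exists_of_filtration {V : Type*} [AddCommGroup V] [Module ℂ V] (f : V →ₗ[ℂ] V)
    (G : ℕ → Submodule ℂ V) (hG : Antitone G)
    (hf : ∀ k, ∀ x ∈ G k, f x - (2 : ℂ) ^ k • x ∈ G (k + 1)) {n : ℕ}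
    (hn : ∀ k, n < k → G k = ⊥) {z : V} (hz : z ∈ G 2) :
    ∃ y ∈ G 2, f y - (2 : ℂ) • y = z := by
  have key : ∀ j k, n < k + 2 + j → ∀ z ∈ G (k + 2), ∃ y ∈ G 2, f y - (2 : ℂ) • y = z := by
    intro j
    induction j with
    | zero =>
      intro k hk z hz
      rw [hn _ hk, Submodule.mem_bot] at hz
      exact ⟨0, zero_mem _, by simp [hz]⟩
    | succ j ih =>
      intro k hk z hz
      have hc : (2 : ℂ) ^ (k + 2) - 2 ≠ 0 := by
        rw [sub_ne_zero]
        intro h2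
        have h3 : 2 ^ (k + 2) = 2 := by exact_mod_cast h2
        have := Nat.one_lt_two_pow (Nat.succ_ne_zero k)
        rw [pow_succ] at h3
        omega
      -- The right-hand side is minus the error left by the first approximation `(2^(k+2) - 2)⁻¹ •
      -- z`.
      obtain ⟨y, hy, hyz⟩ := ih (k + 1) (by omega)
        (-(((2 : ℂ) ^ (k + 2) - 2)⁻¹ • (f z - (2 : ℂ) ^ (k + 2) • z)))
        (Submodule.neg_mem _ (Submodule.smul_mem _ _ (hf _ z hz)))
      refine ⟨((2 : ℂ) ^ (k + 2) - 2)⁻¹ • z + y, Submodule.add_mem _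
        (Submodule.smul_mem _ _ (hG (by omega) hz)) hy, ?_⟩
      have e : f (((2 : ℂ) ^ (k + 2) - 2)⁻¹ • z + y) - (2 : ℂ) • (((2 : ℂ) ^ (k + 2) - 2)⁻¹ • z + y)
          = ((2 : ℂ) ^ (k + 2) - 2)⁻¹ • (f z - (2 : ℂ) • z) + (f y - (2 : ℂ) • y) := by
        simp only [map_add, map_smul, smul_add, smul_sub, smul_comm (2 : ℂ)]
        abel
      rw [e, hyz, ← sub_eq_add_neg, ← smul_sub, sub_sub_sub_cancel_left, ← sub_smul, smul_smul,
        inv_mul_cancel₀ hc, one_smul]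
  exact key n 0 (by omega) z hz

theorem adams_sub_mem {k n : ℕ} {x : ChordSpace} (hx : x ∈ products k n) :
    adams x - (2 : ℂ) ^ k • x ∈ products (k + 1) n :=
  sub_two_pow_smul_mem adams (products · n) (fun _ _ h => products_mono h le_rfl)
    (by
      rintro z ⟨l, m, hl, hm, h⟩
      exact ⟨l, hl, products_mono le_rfl hm h.mem, products_mono le_rfl hm h.adams_sub_mem⟩) hx

theorem map_adams_sub_mem {k n : ℕ} {x : ChordSpace ⊗[ℂ] ChordSpace}
    (hx : x ∈ tensorProducts k n) :
    TensorProduct.map adams adams x - (2 : ℂ) ^ k • x ∈ tensorProducts (k + 1) n := by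
  refine sub_two_pow_smul_mem _ (tensorProducts · n) (fun _ _ h => tensorProducts_mono h le_rfl)
    ?_ hx
  rintro _ ⟨l, m, l', m', a, b, hl, hm, ha, hb, rfl⟩
  refine ⟨l + l', hl, tensorProducts_mono le_rfl hm (tmul_mem_tensorProducts ha.mem hb.mem), ?_⟩
  have e : TensorProduct.map adams adams (a ⊗ₜ[ℂ] b) - (2 : ℂ) ^ (l + l') • a ⊗ₜ[ℂ] b =
      (adams a - (2 : ℂ) ^ l • a) ⊗ₜ[ℂ] adams b +
      (2 : ℂ) ^ l • a ⊗ₜ[ℂ] (adams b - (2 : ℂ) ^ l' • b) := by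
    simp only [TensorProduct.map_tmul, TensorProduct.sub_tmul, TensorProduct.tmul_sub, smul_sub,
      ← TensorProduct.smul_tmul', TensorProduct.tmul_smul, smul_smul, pow_add]
    abel
  rw [e]
  refine Submodule.add_mem _ ?_ (Submodule.smul_mem _ _ ?_)
  · exact tensorProducts_mono (by omega) hm
      (tmul_mem_tensorProducts ha.adams_sub_mem hb.adams_mem)
  · exact tensorProducts_mono (by omega) hm
      (tmul_mem_tensorProducts ha.mem hb.adams_sub_mem)

/-! ### Primitive and decomposable elements -/

theorem mem_primitives {x : ChordSpace} :
    x ∈ primitives ↔ comul x = 1 ⊗ₜ[ℂ] x + x ⊗ₜ[ℂ] 1 := Iff.rfl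

theorem adams_of_primitive {x : ChordSpace} (h : x ∈ primitives) : adams x = (2 : ℂ) • x := by
  rw [adams, LinearMap.comp_apply, mem_primitives.1 h]
  simp [two_smul]

/-- The reduced coproduct of `x` is an eigenvector of `ψ ⊗ ψ` for 2, by `comul_adams`. It lies among
tensors with at least two factors, where only 0 has this property. Membership in `products 1 n`
keeps the unit out. -/
theorem primitive_of_adams {x : ChordSpace} {n : ℕ} (hx : x ∈ products 1 n)
    (h : adams x = (2 : ℂ) • x) : x ∈ primitives := by
  rw [mem_primitives, ← sub_eq_zero]
  let r : ChordSpace →ₗ[ℂ] ChordSpace ⊗[ℂ] ChordSpace := comul -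
    (TensorProduct.mk ℂ ChordSpace ChordSpace 1 + (TensorProduct.mk ℂ ChordSpace ChordSpace).flip 1)
  have hr : products 1 n ≤ (tensorProducts 2 n).comap r := by
    refine Submodule.span_le.2 ?_
    rintro z ⟨l, m, hl, hm, hz⟩
    have hm0 := hz.le
    obtain ⟨D, rfl, rfl⟩ := hz.exists_diagram
    refine tensorProducts_mono le_rfl hm (reduced_comul_mem D ?_)
    rintro h0
    simp [h0] at hm0
    omega
  refine eq_zero_of_filtration (TensorProduct.map adams adams) (tensorProducts · n)
    (fun k x hx => map_adams_sub_mem hx) (fun k hk => tensorProducts_eq_bot hk) (hr hx) ?_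
  rw [map_sub, map_add, ← comul_adams, TensorProduct.map_tmul, TensorProduct.map_tmul, h, adams_one,
    map_smul, smul_sub, smul_add, TensorProduct.tmul_smul, ← TensorProduct.smul_tmul']

theorem decomposables_of_mem_products {x : ChordSpace} {n : ℕ} (hx : x ∈ products 2 n) :
    x ∈ decomposables := by
  refine Submodule.span_le.2 ?_ hx
  rintro z ⟨l, m, hl, hm, hz⟩
  cases hz with
  | one => omega
  | cons D hD h =>
    have h0 := h.le
    obtain ⟨E, rfl, rfl⟩ := h.exists_diagram
    refine Submodule.subset_span (Or.inr ⟨D.cat E, ⟨D.word.map (2 * ·), ?_⟩,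
      ⟨E.word.map (2 * · + 1), ?_⟩, ?_, ?_, rfl, cls_mul_cls D E⟩)
    · intro a ha
      obtain ⟨x, hx, rfl⟩ := List.mem_map.1 ha
      rw [List.count_map_of_injective (f := (2 * ·)) _ (fun a b h => by simpa using h) x,
        D.count_eq_two x hx]
    · intro a ha
      obtain ⟨x, hx, rfl⟩ := List.mem_map.1 ha
      rw [List.count_map_of_injective (f := (2 * · + 1)) _ (fun a b h => by simpa using h) x,
        E.count_eq_two x hx]
    · simpa using hD
    · have : 0 < E.word.length := by omega
      simpa using List.length_pos_iff.1 this

theorem exists_of_mem_decomposables {x : ChordSpace} (hx : x ∈ decomposables) :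
    ∃ (c : ℂ) (n : ℕ), ∃ y ∈ products 2 n, x = c • 1 + y := by
  induction hx using Submodule.span_induction with
  | mem z hz =>
    rcases hz with rfl | ⟨D, D₁, D₂, h1, h2, h, rfl⟩
    · exact ⟨1, 0, 0, zero_mem _, by simp [unit_eq_one]⟩
    · refine ⟨0, _, _, ((IsMonomial.of_diagram D₁ h1).mul (IsMonomial.of_diagram D₂ h2)).mem, ?_⟩
      rw [zero_smul, zero_add, cls_mul_cls]
      exact (cls_cat_of_word D₁ D₂ D id id Function.injective_id Function.injective_id
        (by simp [h])).symm
  | zero => exact ⟨0, 0, 0, zero_mem _, by simp⟩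
  | add a b _ _ ha hb =>
    obtain ⟨c, n, y, hy, rfl⟩ := ha
    obtain ⟨d, m, z, hz, rfl⟩ := hb
    refine ⟨c + d, max n m, y + z, Submodule.add_mem _ (products_mono le_rfl (le_max_left _ _) hy)
      (products_mono le_rfl (le_max_right _ _) hz), ?_⟩
    rw [add_smul]; abel
  | smul t a _ ha =>
    obtain ⟨c, n, y, hy, rfl⟩ := ha
    exact ⟨t * c, n, t • y, Submodule.smul_mem _ _ hy, by rw [smul_add, smul_smul]⟩

/-! ### The polynomial counting chords -/

theorem two_le_length (D : ArcDiagram) (h : D.word ≠ []) : 2 ≤ D.word.length := by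
  obtain ⟨a, l, hl⟩ := List.exists_cons_of_ne_nil h
  rw [← D.count_eq_two a (by simp [hl])]
  exact List.count_le_length

/-- The constant term serves as the counit, the linear coefficient is the obstruction to
independence of `ε`, and the whole polynomial gives the correction to `F`. -/
theorem exists_chordGenerating : ∃ F : ChordSpace →ₗ[ℂ] ℂ[X], ∀ D : ArcDiagram,
    F D.close.cls = Polynomial.X ^ (D.word.length / 2) := by
  refine exists_lift _ ?_ ?_
  · intro D E h
    exact congrArg _ (congrArg ChordDiagram.numChords (close_eq_of_step h))
  · intro D₁ D₂ D₃ D₄ u v w a b h₁ h₂ h₃ h₄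
    have e₂ : D₂.word.length = D₁.word.length := by rw [h₁, h₂]; simp
    have e₃ : D₃.word.length = D₁.word.length := by rw [h₁, h₃]; simp; omega
    have e₄ : D₄.word.length = D₁.word.length := by rw [h₁, h₄]; simp; omega
    rw [e₂, e₃, e₄]; simp

/-- The linear map which sends a diagram with `n` chords to `X ^ n`. -/
def chordGenerating : ChordSpace →ₗ[ℂ] ℂ[X] := exists_chordGenerating.choose

theorem chordGenerating_cls (D : ArcDiagram) :
    chordGenerating D.close.cls = Polynomial.X ^ (D.word.length / 2) :=
  exists_chordGenerating.choose_spec D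

theorem chordGenerating_one : chordGenerating 1 = 1 :=
  (chordGenerating_cls ArcDiagram.empty).trans (by simp [ArcDiagram.empty])

theorem coeff_chordGenerating {k n : ℕ} {x : ChordSpace} (hx : x ∈ products k n) {i : ℕ}
    (hi : i < k) : (chordGenerating x).coeff i = 0 := by
  suffices products k n ≤ LinearMap.ker (Polynomial.lcoeff ℂ i ∘ₗ chordGenerating) from this hx
  refine Submodule.span_le.2 ?_
  rintro z ⟨l, m, hl, hm, hz⟩
  suffices ∃ j, l ≤ j ∧ chordGenerating z = Polynomial.X ^ j by
    obtain ⟨j, hj, h⟩ := this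
    simp only [SetLike.mem_coe, LinearMap.mem_ker, LinearMap.comp_apply, h,
      Polynomial.lcoeff_apply, Polynomial.coeff_X_pow]
    rw [if_neg (by omega)]
  clear hl hm
  induction hz with
  | one => exact ⟨0, le_rfl, by rw [chordGenerating_one, pow_zero]⟩
  | cons D hD h ih =>
    obtain ⟨E, rfl, rfl⟩ := h.exists_diagram
    obtain ⟨j, hj, h⟩ := ih
    refine ⟨(D.word.length + E.word.length) / 2, ?_, ?_⟩
    · have h1 := two_le_length D hD
      rw [chordGenerating_cls] at h
      have h2 := congrArg Polynomial.natDegree h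
      rw [Polynomial.natDegree_X_pow, Polynomial.natDegree_X_pow] at h2
      omega
    · rw [cls_mul_cls, chordGenerating_cls]; simp [ArcDiagram.cat]

theorem coeff_zero_chordGenerating_adams (x : ChordSpace) :
    (chordGenerating (adams x)).coeff 0 = (chordGenerating x).coeff 0 := by
  suffices Polynomial.lcoeff ℂ 0 ∘ₗ chordGenerating ∘ₗ adams =
    Polynomial.lcoeff ℂ 0 ∘ₗ chordGenerating from LinearMap.congr_fun this x
  refine lin_ext fun D => ?_
  simp only [LinearMap.comp_apply, Polynomial.lcoeff_apply]
  by_cases hD : D.word = []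
  · rw [cls_eq_one D hD, adams_one]
  · rw [coeff_chordGenerating (IsMonomial.of_diagram D hD).adams_mem one_pos,
      coeff_chordGenerating (IsMonomial.of_diagram D hD).mem one_pos]

/-- The constant term is preserved by `adams`, which doubles a primitive element. -/
theorem coeff_zero_of_primitive {x : ChordSpace} (h : x ∈ primitives) :
    (chordGenerating x).coeff 0 = 0 := by
  have h1 := coeff_zero_chordGenerating_adams x
  rw [adams_of_primitive h, map_smul, Polynomial.coeff_smul, two_smul] at h1
  simpa using h1

theorem isCompl_primitives_decomposables : IsCompl primitives decomposables := by
  refine ⟨Submodule.disjoint_def.2 fun x hx hx' => ?_, codisjoint_iff.2 (eq_top_iff.2 ?_)⟩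
  -- The constant term removes the unit; the remainder is an eigenvector for 2 made of products of
  -- at least two factors.
  · obtain ⟨c, n, y, hy, rfl⟩ := exists_of_mem_decomposables hx'
    have h0 := coeff_zero_of_primitive hx
    rw [map_add, map_smul, Polynomial.coeff_add, coeff_chordGenerating hy two_pos,
      chordGenerating_one] at h0
    have hc : c = 0 := by simpa using h0
    rw [hc, zero_smul, zero_add] at hx ⊢
    exact eq_zero_of_filtration adams (products · n) (fun k x hx => adams_sub_mem hx)
      (fun k hk => products_eq_bot hk) hy (adams_of_primitive hx)
  · rintro x -
    induction x using cls_induction with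
    | zero => exact zero_mem _
    | add x y hx hy => exact add_mem hx hy
    | smul c x hx => exact Submodule.smul_mem _ _ hx
    | cls D =>
      by_cases hD : D.word = []
      · refine Submodule.mem_sup_right (Submodule.subset_span (Or.inl ?_))
        rw [cls_eq_one D hD]; rfl
      -- The correction `y` absorbs the defect of `D` from being an eigenvector, so `D - y` is an
      -- eigenvector for 2 and hence primitive.
      · obtain ⟨y, hy, hyz⟩ := exists_of_filtration adams (products · D.word.length)
          (fun _ _ h => products_mono h le_rfl) (fun k x hx => adams_sub_mem hx)
          (fun k hk => products_eq_bot hk) (adams_cls_sub_mem D hD)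
        have hp : D.close.cls - y ∈ primitives := by
          refine primitive_of_adams (n := D.word.length) (Submodule.sub_mem _
            (IsMonomial.of_diagram D hD).mem (products_mono one_le_two le_rfl hy)) ?_
          rw [map_sub, smul_sub, sub_eq_sub_iff_sub_eq_sub, hyz]
        have := Submodule.add_mem_sup hp (decomposables_of_mem_products hy)
        simpa using this

theorem existsUnique_primitiveProjection :
    ∃! π : ChordSpace →ₗ[ℂ] ChordSpace, IsPrimitiveProjection π := by
  have hc := isCompl_primitives_decomposables
  refine ⟨primitives.projection decomposables hc,
    ⟨⟨Submodule.projection_apply_mem hc, fun x hx => Submodule.projection_apply_of_mem_left hc hx⟩,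
      Submodule.ker_projection hc⟩, ?_⟩
  rintro π ⟨hπ, hk⟩
  refine LinearMap.ext fun x => ?_
  obtain ⟨p, hp, d, hd, rfl⟩ := Submodule.mem_sup.1
    ((codisjoint_iff.1 hc.codisjoint).symm ▸ Submodule.mem_top : x ∈ primitives ⊔ decomposables)
  have h0 : π d = 0 := by rwa [← LinearMap.mem_ker, hk]
  rw [map_add, map_add, hπ.map_id p hp, Submodule.projection_apply_of_mem_left hc hp, h0,
    (Submodule.projection_apply_eq_zero_iff hc).2 hd]


/-! ### Sums over closed paths -/

section PairSum

variable {A : Type*} [Ring A] {n : Type*} [Fintype n]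
  {I : Type} [Fintype I] [DecidableEq I]

/-- The sum over all labellings of the product of the elements `e` indexed by the given pairs of
labels. -/
def pairSum (e : n → n → A) (l : List (I × I)) : A :=
  ∑ i : I → n, (l.map fun p => e (i p.1) (i p.2)).prod

theorem pairSum_map_equiv {J : Type} [Fintype J] [DecidableEq J] (e : n → n → A) (f : J ≃ I)
    (l : List (J × J)) : pairSum e (l.map (Prod.map f f)) = pairSum e l := by
  rw [pairSum, pairSum, ← (f.arrowCongr (Equiv.refl n)).sum_comp]
  simp [List.map_map, Function.comp_def]

theorem pairSum_sum {J : Type} [Fintype J] [DecidableEq J] (e : n → n → A) (l : List (I × I))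
    (l' : List (J × J)) :
    pairSum e (l.map (Prod.map Sum.inl Sum.inl) ++ l'.map (Prod.map (Sum.inr (α := I)) Sum.inr)) =
      pairSum e l * pairSum e l' := by
  simp only [pairSum]
  rw [← (Equiv.sumArrowEquivProdArrow I J n).symm.sum_comp, Fintype.sum_prod_type,
    Finset.sum_mul_sum]
  simp [List.map_map, Function.comp_def, Equiv.sumArrowEquivProdArrow]

variable [DecidableEq n]

theorem matrix_pow_apply (e : Matrix n n A) (k : ℕ) (x y : n) :
    (e ^ (k + 1)) x y = ∑ i : Fin k → n, (List.ofFn fun j : Fin (k + 1) =>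
      e (Fin.cons (α := fun _ => n) x i j) (Fin.snoc (α := fun _ => n) i y j)).prod := by
  induction k generalizing x with
  | zero => simp [Fin.snoc]
  | succ k ih =>
    rw [pow_succ', Matrix.mul_apply]
    simp only [ih]
    rw [← (Fin.consEquiv fun _ : Fin (k + 1) => n).sum_comp, Fintype.sum_prod_type]
    refine Finset.sum_congr rfl fun z _ => ?_
    rw [Finset.mul_sum]
    refine Finset.sum_congr rfl fun i _ => ?_
    conv_rhs => rw [List.ofFn_succ, List.prod_cons]
    have h := Fin.cons_snoc_eq_snoc_cons z i y
    simp only [Fin.consEquiv, Equiv.coe_fn_mk, ← h, Fin.cons_zero, Fin.cons_succ]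

/-- Over a noncommutative ring, powers of a matrix are still ordered sums over paths. This makes
`C_k` the trace of a matrix power. -/
theorem trace_matrix_pow (e : Matrix n n A) (k : ℕ) :
    (e ^ (k + 1)).trace = ∑ i : Fin (k + 1) → n, (List.ofFn fun j : Fin (k + 1) =>
      e (i j) (i (finRotate _ j))).prod := by
  rw [← (Fin.consEquiv fun _ : Fin (k + 1) => n).sum_comp, Fintype.sum_prod_type, Matrix.trace]
  refine Finset.sum_congr rfl fun z _ => ?_
  rw [Matrix.diag_apply, matrix_pow_apply]
  simp only [Fin.snoc_eq_cons_rotate, Fin.consEquiv, Equiv.coe_fn_mk]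

/-- The commutation relations of the matrix units in a representation of `gl`. -/
def GlRelations (e : n → n → A) : Prop :=
  ∀ a b c d, e a b * e c d - e c d * e a b =
    (if b = c then e a d else 0) - (if d = a then e c b else 0)

/-- The commutator with `e a b` is a derivation; at each inner index of a path the two delta terms
cancel, leaving only the terms of the endpoints. -/
theorem GlRelations.pow {e : Matrix n n A} (he : GlRelations e) (k : ℕ) (a b c d : n) :
    e a b * (e ^ k) c d - (e ^ k) c d * e a b =
      (if b = c then (e ^ k) a d else 0) - (if d = a then (e ^ k) c b else 0) := by
  induction k generalizing c d with
  | zero =>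
    simp only [pow_zero, Matrix.one_apply]
    by_cases h : c = d <;> by_cases h1 : b = c <;> by_cases h2 : d = a <;>
      simp_all [eq_comm]
  | succ k ih =>
    have e1 : e a b * (e ^ (k + 1)) c d - (e ^ (k + 1)) c d * e a b =
        ∑ x, ((e a b * (e ^ k) c x - (e ^ k) c x * e a b) * e x d +
          (e ^ k) c x * (e a b * e x d - e x d * e a b)) := by
      rw [pow_succ, Matrix.mul_apply, Finset.mul_sum, Finset.sum_mul, ← Finset.sum_sub_distrib]
      exact Finset.sum_congr rfl fun x _ => by noncomm_ring
    rw [e1]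
    simp only [ih, he a b]
    simp only [sub_mul, mul_sub, ite_mul, mul_ite, zero_mul, mul_zero, Finset.sum_add_distrib,
      Finset.sum_sub_distrib, Finset.sum_ite_eq', Finset.sum_ite_eq, Finset.mem_univ, if_true,
      pow_succ, Matrix.mul_apply]
    rcases eq_or_ne b c with rfl | h1 <;> rcases eq_or_ne d a with rfl | h2 <;>
      simp [*]
    abel

theorem GlRelations.commute_trace {e : Matrix n n A} (he : GlRelations e) (k : ℕ) (a b : n) :
    e a b * (e ^ k).trace = (e ^ k).trace * e a b := by
  rw [← sub_eq_zero, Matrix.trace, Finset.mul_sum, Finset.sum_mul, ← Finset.sum_sub_distrib]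
  simp only [Matrix.diag_apply, he.pow, Finset.sum_sub_distrib, Finset.sum_ite_eq,
    Finset.sum_ite_eq', Finset.mem_univ, if_true, sub_self]

/-- The part of `pairSum` with the labels `b` and `c` equal. -/
def deltaSum (e : n → n → A) (b c : I) (l : List (I × I)) : A :=
  ∑ i : I → n, if i b = i c then (l.map fun p => e (i p.1) (i p.2)).prod else 0

/-- The commutator of two neighbouring factors replaces them by a single one, so the correction
terms are shorter. -/
theorem pairSum_swap {e : n → n → A} (he : GlRelations e) (u v : List (I × I)) (a b c d : I) :
    pairSum e (u ++ (a, b) :: (c, d) :: v) = pairSum e (u ++ (c, d) :: (a, b) :: v) +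
      (deltaSum e b c (u ++ (a, d) :: v) - deltaSum e d a (u ++ (c, b) :: v)) := by
  rw [← sub_eq_iff_eq_add', pairSum, pairSum, deltaSum, deltaSum, ← Finset.sum_sub_distrib,
    ← Finset.sum_sub_distrib]
  refine Finset.sum_congr rfl fun i _ => ?_
  simp only [List.map_append, List.map_cons, List.prod_append, List.prod_cons]
  generalize (u.map fun p => e (i p.1) (i p.2)).prod = U
  generalize (v.map fun p => e (i p.1) (i p.2)).prod = V
  have h : U * (e (i a) (i b) * (e (i c) (i d) * V)) - U * (e (i c) (i d) * (e (i a) (i b) * V)) =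
    U * ((e (i a) (i b) * e (i c) (i d) - e (i c) (i d) * e (i a) (i b)) * V) := by noncomm_ring
  rw [h, he]
  split_ifs <;> noncomm_ring

theorem deltaSum_self (e : n → n → A) (b : I) (l : List (I × I)) :
    deltaSum e b b l = pairSum e l := by
  simp [deltaSum, pairSum]

/-- The map which identifies the label `c` with `b`. -/
def mergeLabel {b c : I} (h : b ≠ c) (x : I) : {x : I // x ≠ c} :=
  if hx : x = c then ⟨b, h⟩ else ⟨x, hx⟩

theorem deltaSum_of_ne (e : n → n → A) {b c : I} (h : b ≠ c) (l : List (I × I)) :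
    deltaSum e b c l = pairSum e (l.map (Prod.map (mergeLabel h) (mergeLabel h))) := by
  rw [deltaSum, pairSum, ← Finset.sum_filter]
  refine Finset.sum_nbij' (fun i x => i x.1) (fun i x => i (mergeLabel h x)) ?_ ?_ ?_ ?_ ?_
  · simp
  · intro i _
    simp [mergeLabel, h]
  · intro i hi
    simp only [Finset.mem_filter, Finset.mem_univ, true_and] at hi
    funext x
    by_cases hx : x = c
    · simp [mergeLabel, hx, hi]
    · simp [mergeLabel, hx]
  · intro i _
    funext x
    simp [mergeLabel, x.2]
  · intro i hi
    simp only [Finset.mem_filter, Finset.mem_univ, true_and] at hi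
    have : ∀ x, i (mergeLabel h x).1 = i x := by
      intro x
      by_cases hx : x = c
      · simp [mergeLabel, hx, hi]
      · simp [mergeLabel, hx]
    simp [List.map_map, Function.comp_def, this]

end PairSum

/-! ### Balanced lists of pairs and their cycles -/

/-- Every label occurs as often (and at most once) as the first and as the second element of a
pair. -/
def Balanced {I : Type} (l : List (I × I)) : Prop :=
  (l.map Prod.fst).Perm (l.map Prod.snd) ∧ (l.map Prod.fst).Nodup

theorem Balanced.perm {I : Type} {l l' : List (I × I)} (h : Balanced l) (hl : l.Perm l') :
    Balanced l' :=
  ⟨((hl.map _).symm.trans h.1).trans (hl.map _), ((hl.map _).nodup_iff).1 h.2⟩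

/-- After a commutator the label `c` is missing among the first elements and `b` among the second
ones. Identifying the two restores the balance. -/
theorem Balanced.merge {I : Type} [DecidableEq I] {l : List (I × I)} {b c : I} (hbc : b ≠ c)
    (h : (c :: l.map Prod.fst).Perm (b :: l.map Prod.snd)) (hn : (c :: l.map Prod.fst).Nodup) :
    Balanced (l.map (Prod.map (mergeLabel hbc) (mergeLabel hbc))) := by
  have h' := h.map (mergeLabel hbc)
  have e : mergeLabel hbc c = mergeLabel hbc b := by simp [mergeLabel, hbc]
  rw [List.map_cons, List.map_cons, e, List.perm_cons] at h'
  have e1 : (l.map (Prod.map (mergeLabel hbc) (mergeLabel hbc))).map Prod.fst =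
    (l.map Prod.fst).map (mergeLabel hbc) := by simp [Function.comp_def]
  have e2 : (l.map (Prod.map (mergeLabel hbc) (mergeLabel hbc))).map Prod.snd =
    (l.map Prod.snd).map (mergeLabel hbc) := by simp [Function.comp_def]
  refine ⟨by rw [e1, e2]; exact h', ?_⟩
  rw [e1]
  rw [List.nodup_cons] at hn
  refine (List.nodup_map_iff_inj_on hn.2).2 fun x hx y hy hxy => ?_
  have hxc : x ≠ c := fun h => hn.1 (h ▸ hx)
  have hyc : y ≠ c := fun h => hn.1 (h ▸ hy)
  simpa [mergeLabel, hxc, hyc] using hxy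

/-- A balanced list is the graph of a permutation of the labels it uses; the orbit of one label is
the required cycle. -/
theorem Balanced.exists_cycle {I : Type} [Finite I] {l : List (I × I)} (h : Balanced l)
    (hl : l ≠ []) : ∃ (k : ℕ) (a : Fin (k + 1) → I) (r : List (I × I)), Function.Injective a ∧
      l.Perm (List.ofFn (fun j => (a j, a (finRotate _ j))) ++ r) := by
  classical
  have hn2 : (l.map Prod.snd).Nodup := h.1.nodup_iff.1 h.2
  obtain ⟨p, hp⟩ := List.exists_mem_of_ne_nil l hl
  let F : Set I := {x | x ∈ l.map Prod.fst}
  -- The successor permutation, extended by the identity to unused labels; injectivity on the finite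
  -- type `I` makes every point periodic.
  let s : I → I := fun x => if hx : ∃ y, (x, y) ∈ l then hx.choose else x
  have hs : ∀ x ∈ F, (x, s x) ∈ l := by
    intro x hx
    obtain ⟨q, hq, rfl⟩ := List.mem_map.1 hx
    have hx' : ∃ y, (q.1, y) ∈ l := ⟨q.2, hq⟩
    simp only [s, dif_pos hx']
    exact hx'.choose_spec
  have hs' : ∀ x, x ∉ F → s x = x := by
    intro x hx
    refine dif_neg ?_
    rintro ⟨y, hy⟩
    exact hx (List.mem_map.2 ⟨_, hy, rfl⟩)
  have hF : ∀ x ∈ F, s x ∈ F := fun x hx =>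
    h.1.mem_iff.2 (List.mem_map.2 ⟨_, hs x hx, rfl⟩)
  have hinj : Function.Injective s := by
    intro x y hxy
    by_cases hx : x ∈ F <;> by_cases hy : y ∈ F
    · exact congrArg Prod.fst (List.inj_on_of_nodup_map hn2 (hs x hx) (hs y hy) hxy)
    · rw [hs' y hy] at hxy
      exact absurd (hxy ▸ hF x hx) hy
    · rw [hs' x hx] at hxy
      exact absurd (hxy ▸ hF y hy) hx
    · rwa [hs' x hx, hs' y hy] at hxy
  have hpos := Function.minimalPeriod_pos_of_mem_periodicPts (hinj.mem_periodicPts p.1)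
  obtain ⟨k, hk⟩ : ∃ k, Function.minimalPeriod s p.1 = k + 1 := ⟨_, (Nat.succ_pred hpos.ne').symm⟩
  let a : Fin (k + 1) → I := fun j => s^[j] p.1
  have ha : Function.Injective a := by
    intro i j hij
    refine Fin.ext (Function.iterate_injOn_Iio_minimalPeriod ?_ ?_ hij) <;> rw [hk, Set.mem_Iio]
    exacts [i.2, j.2]
  have haF : ∀ j : ℕ, s^[j] p.1 ∈ F := by
    intro j
    induction j with
    | zero => exact List.mem_map.2 ⟨p, hp, rfl⟩
    | succ j ih => rw [Function.iterate_succ_apply']; exact hF _ ih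
  have hrot : ∀ j, a (finRotate _ j) = s (a j) := by
    intro j
    simp only [a]
    rw [← Function.iterate_succ_apply' s, ← Function.iterate_mod_minimalPeriod_eq (n := j + 1), hk,
      finRotate_apply, Fin.val_add]
    simp
  have hsub : List.ofFn (fun j => (a j, a (finRotate _ j))) ⊆ l := by
    intro q hq
    obtain ⟨j, rfl⟩ := (List.mem_ofFn' _ _).1 hq
    simp only [hrot]
    exact hs _ (haF j)
  have hnd : (List.ofFn (fun j => (a j, a (finRotate _ j)))).Nodup :=
    List.nodup_ofFn.2 fun i j hij => ha (congrArg Prod.fst hij)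
  obtain ⟨l', h1, h2⟩ := List.subperm_of_subset hnd hsub
  obtain ⟨r, hr⟩ := h2.exists_perm_append
  exact ⟨k, a, r, ha, hr.trans (h1.append_right r)⟩

/-- The labels of the remainder are all those off the cycle, including labels occurring in no pair:
these still contribute factors `N`. -/
theorem Balanced.exists_split {I : Type} [Finite I] {l : List (I × I)} (h : Balanced l)
    (hl : l ≠ []) : ∃ (k : ℕ) (B : Type) (_ : Finite B) (f : Fin (k + 1) ⊕ B ≃ I)
      (r : List (B × B)), Balanced r ∧
      l.Perm ((((List.ofFn fun j => (j, finRotate (k + 1) j)).map (Prod.map Sum.inl Sum.inl)) ++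
        r.map (Prod.map Sum.inr Sum.inr)).map (Prod.map f f)) := by
  classical
  obtain ⟨k, a, r, ha, hr⟩ := h.exists_cycle hl
  have hb := h.perm hr
  have e1 : (List.ofFn fun j => (a j, a (finRotate _ j))).map Prod.fst = List.ofFn a := by
    rw [List.map_ofFn]; rfl
  have e2 : (List.ofFn fun j => (a j, a (finRotate _ j))).map Prod.snd =
    List.ofFn (a ∘ finRotate _) := by
    rw [List.map_ofFn]; rfl
  have hp := hb.1
  have hn := hb.2
  rw [List.map_append, List.map_append, e1, e2] at hp
  rw [List.map_append, e1] at hn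
  have hp' := (hp.trans ((Equiv.Perm.ofFn_comp_perm _ a).append_right _))
  rw [List.perm_append_left_iff] at hp'
  have hd1 : ∀ x ∈ r.map Prod.fst, x ∉ Set.range a := by
    rintro x hx ⟨j, rfl⟩
    exact (List.nodup_append.1 hn).2.2 _ ((List.mem_ofFn' _ _).2 ⟨j, rfl⟩) _ hx rfl
  have hd2 : ∀ x ∈ r.map Prod.snd, x ∉ Set.range a := fun x hx => hd1 x (hp'.mem_iff.2 hx)
  let r' : List ({x // x ∈ (Set.range a)ᶜ} × {x // x ∈ (Set.range a)ᶜ}) :=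
    r.attach.map fun p => (⟨p.1.1, hd1 _ (List.mem_map.2 ⟨_, p.2, rfl⟩)⟩,
      ⟨p.1.2, hd2 _ (List.mem_map.2 ⟨_, p.2, rfl⟩)⟩)
  have hr' : r'.map (Prod.map Subtype.val Subtype.val) = r := by
    simp only [r', List.map_map, Function.comp_def, Prod.map]
    exact List.attach_map_subtype_val r
  have f1 : (r'.map Prod.fst).map Subtype.val = r.map Prod.fst := by
    rw [← hr']; simp [Function.comp_def]
  have f2 : (r'.map Prod.snd).map Subtype.val = r.map Prod.snd := by
    rw [← hr']; simp [Function.comp_def]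
  refine ⟨k, {x // x ∈ (Set.range a)ᶜ}, inferInstance,
    (Equiv.sumCongr (Equiv.ofInjective a ha) (Equiv.refl _)).trans (Equiv.Set.sumCompl _), r',
    ⟨?_, ?_⟩, ?_⟩
  · rw [← List.map_perm_map_iff Subtype.val_injective, f1, f2]
    exact hp'
  · refine List.Nodup.of_map Subtype.val ?_
    rw [f1]
    exact (List.nodup_append.1 hn).2.1
  · refine hr.trans (List.Perm.of_eq ?_)
    rw [List.map_append, List.map_map, List.map_map, List.map_ofFn]
    congr 1
    conv_lhs => rw [← hr']
    exact List.map_congr_left fun q _ => rfl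


/-! ### Existence of the universal `gl` weight system -/

theorem glRelations_single (n : Type*) [Fintype n] [DecidableEq n] :
    GlRelations fun i j : n => Matrix.single i j (1 : ℂ) := by
  intro a b c d
  by_cases h1 : b = c <;> by_cases h2 : d = a <;>
    simp [h1, h2, Matrix.single_mul_single_of_ne]

theorem glRelations_matrixUnit (N : ℕ) : GlRelations (matrixUnit N) := by
  intro a b c d
  have h : ⁅matrixUnit N a b, matrixUnit N c d⁆ = UniversalEnvelopingAlgebra.ι ℂ
      ⁅Matrix.single a b (1 : ℂ), Matrix.single c d (1 : ℂ)⁆ := (LieHom.map_lie _ _ _).symm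
  rw [LieRing.of_associative_ring_bracket, LieRing.of_associative_ring_bracket,
    glRelations_single (Fin N) a b c d, map_sub] at h
  rw [h]
  congr 1 <;> split_ifs <;> first | rfl | exact map_zero _

theorem pairSum_ofFn (N : ℕ) {m : ℕ} (α : Equiv.Perm (Fin m)) :
    pairSum (matrixUnit N) (List.ofFn fun k => (k, α k)) = glWeight N α := by
  simp only [pairSum, glWeight, List.map_ofFn]
  rfl

theorem casimir_succ (N k : ℕ) :
    casimir N (k + 1) = (Matrix.of (matrixUnit N) ^ (k + 1)).trace := by
  rw [trace_matrix_pow]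
  rfl

theorem mem_center_of_commute (N : ℕ) {z : Ugl N}
    (h : ∀ a b, matrixUnit N a b * z = z * matrixUnit N a b) :
    z ∈ Subalgebra.center ℂ (Ugl N) := by
  rw [Subalgebra.mem_center_iff]
  intro y
  obtain ⟨t, rfl⟩ : ∃ t, UniversalEnvelopingAlgebra.mkAlgHom ℂ (Matrix (Fin N) (Fin N) ℂ) t = y :=
    RingCon.mk'_surjective _ y
  induction t using TensorAlgebra.induction with
  | algebraMap r =>
    rw [AlgHom.commutes]
    exact Algebra.commutes r z
  | mul a b ha hb => rw [map_mul, mul_assoc, hb, ← mul_assoc, ha, mul_assoc]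
  | add a b ha hb => rw [map_add, add_mul, mul_add, ha, hb]
  | ι x =>
    rw [← UniversalEnvelopingAlgebra.ι_apply, Matrix.matrix_eq_sum_single x]
    have e : ∀ i j, Matrix.single i j (x i j) = x i j • Matrix.single i j (1 : ℂ) := fun i j => by
      rw [Matrix.smul_single, smul_eq_mul, mul_one]
    simp only [map_sum, e, map_smul, Finset.sum_mul, Finset.mul_sum, smul_mul_assoc, mul_smul_comm]
    refine Finset.sum_congr rfl fun i _ => Finset.sum_congr rfl fun j _ => ?_
    exact congrArg _ (h i j)

/-- Polynomials can be evaluated only in a commutative algebra; centrality lets `specialize` pass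
through the center of the enveloping algebra. -/
theorem casimir_mem_center (N k : ℕ) : casimir N k ∈ Subalgebra.center ℂ (Ugl N) := by
  rcases k with _ | k
  · have : casimir N 0 = 1 := by simp [casimir, glWeight]
    rw [this]
    exact one_mem _
  have key : ∀ a b, matrixUnit N a b * casimir N (k + 1) = casimir N (k + 1) * matrixUnit N a b := by
    intro a b
    rw [casimir_succ]
    exact GlRelations.commute_trace (e := Matrix.of (matrixUnit N)) (glRelations_matrixUnit N) _ a b
  exact mem_center_of_commute N key

/-- The specialization of a polynomial in `N, C₁, C₂, …` to the universal enveloping algebra. -/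
def specialize (N : ℕ) : MvPolynomial ℕ ℂ →ₐ[ℂ] Ugl N :=
  (Subalgebra.center ℂ (Ugl N)).val.comp (MvPolynomial.aeval fun k =>
    if k = 0 then (N : Subalgebra.center ℂ (Ugl N)) else ⟨casimir N k, casimir_mem_center N k⟩)

theorem specialize_X_zero (N : ℕ) : specialize N (MvPolynomial.X 0) = (N : Ugl N) := by
  simp [specialize]

theorem specialize_X (N : ℕ) {k : ℕ} (hk : 1 ≤ k) :
    specialize N (MvPolynomial.X k) = casimir N k := by
  have : k ≠ 0 := by omega
  simp [specialize, this]

/-- A family of elements of the universal enveloping algebras which is the specialization of a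
single polynomial. -/
def IsUniversal (x : ∀ N, Ugl N) : Prop := ∃ p, ∀ N, specialize N p = x N

theorem IsUniversal.add {x y : ∀ N, Ugl N} : IsUniversal x → IsUniversal y →
    IsUniversal fun N => x N + y N := fun ⟨p, hp⟩ ⟨q, hq⟩ =>
  ⟨p + q, fun N => by rw [map_add, hp, hq]⟩

theorem IsUniversal.sub {x y : ∀ N, Ugl N} : IsUniversal x → IsUniversal y →
    IsUniversal fun N => x N - y N := fun ⟨p, hp⟩ ⟨q, hq⟩ =>
  ⟨p - q, fun N => by rw [map_sub, hp, hq]⟩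

theorem IsUniversal.mul {x y : ∀ N, Ugl N} : IsUniversal x → IsUniversal y →
    IsUniversal fun N => x N * y N := fun ⟨p, hp⟩ ⟨q, hq⟩ =>
  ⟨p * q, fun N => by rw [map_mul, hp, hq]⟩

theorem isUniversal_casimir (k : ℕ) : IsUniversal fun N => casimir N (k + 1) :=
  ⟨_, fun N => specialize_X N (Nat.succ_pos k)⟩

theorem isUniversal_deltaSum {n : ℕ} (ih : ∀ (I : Type) [Fintype I] [DecidableEq I]
    (l : List (I × I)), l.length < n → Balanced l →
      IsUniversal fun N => pairSum (matrixUnit N) l)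
    {I : Type} [Fintype I] [DecidableEq I] {l : List (I × I)} (hl : l.length < n) {b c : I}
    (h : (c :: l.map Prod.fst).Perm (b :: l.map Prod.snd)) (hn : (c :: l.map Prod.fst).Nodup) :
    IsUniversal fun N => deltaSum (matrixUnit N) b c l := by
  by_cases hbc : b = c
  -- Here `b` occurs in no pair: it stays as a free label and accounts for a factor `N`.
  · subst hbc
    simp only [deltaSum_self]
    exact ih I l hl ⟨(List.perm_cons _).1 h, (List.nodup_cons.1 hn).2⟩
  · simp only [deltaSum_of_ne _ hbc]
    exact ih _ _ (by simpa using hl) (Balanced.merge hbc h hn)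

theorem isUniversal_pairSum_swap {I : Type} [Fintype I] [DecidableEq I] (u v : List (I × I))
    (p q : I × I) (ih : ∀ (J : Type) [Fintype J] [DecidableEq J] (l : List (J × J)),
      l.length < (u ++ p :: q :: v).length → Balanced l →
      IsUniversal fun N => pairSum (matrixUnit N) l)
    (hb : Balanced (u ++ p :: q :: v))
    (h : IsUniversal fun N => pairSum (matrixUnit N) (u ++ q :: p :: v)) :
    IsUniversal fun N => pairSum (matrixUnit N) (u ++ p :: q :: v) := by
  obtain ⟨a, b⟩ := p
  obtain ⟨c, d⟩ := q
  have hswap : (fun N => pairSum (matrixUnit N) (u ++ (a, b) :: (c, d) :: v)) = fun N =>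
      pairSum (matrixUnit N) (u ++ (c, d) :: (a, b) :: v) +
      (deltaSum (matrixUnit N) b c (u ++ (a, d) :: v) -
        deltaSum (matrixUnit N) d a (u ++ (c, b) :: v)) :=
    funext fun N => pairSum_swap (glRelations_matrixUnit N) u v a b c d
  rw [hswap]
  have h1 := hb.1
  have h2 := hb.2
  have e1 : ((u ++ (a, b) :: (c, d) :: v).map Prod.fst).Perm
      (c :: (u ++ (a, d) :: v).map Prod.fst) := by
    classical
    rw [List.perm_iff_count]; intro x; simp [List.count_append, List.count_cons]; omega
  have e2 : ((u ++ (a, b) :: (c, d) :: v).map Prod.snd).Perm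
      (b :: (u ++ (a, d) :: v).map Prod.snd) := by
    classical
    rw [List.perm_iff_count]; intro x; simp [List.count_append, List.count_cons]; omega
  have e3 : ((u ++ (a, b) :: (c, d) :: v).map Prod.fst).Perm
      (a :: (u ++ (c, b) :: v).map Prod.fst) := by
    classical
    rw [List.perm_iff_count]; intro x; simp [List.count_append, List.count_cons]; omega
  have e4 : ((u ++ (a, b) :: (c, d) :: v).map Prod.snd).Perm
      (d :: (u ++ (c, b) :: v).map Prod.snd) := by
    classical
    rw [List.perm_iff_count]; intro x; simp [List.count_append, List.count_cons]; omega
  refine h.add ((isUniversal_deltaSum ih ?_ ((e1.symm.trans h1).trans e2) (e1.nodup_iff.1 h2)).sub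
    (isUniversal_deltaSum ih ?_ ((e3.symm.trans h1).trans e4) (e3.nodup_iff.1 h2)))
  · simp
  · simp

theorem isUniversal_pairSum_perm {I : Type} [Fintype I] [DecidableEq I] {n : ℕ}
    (ih : ∀ (J : Type) [Fintype J] [DecidableEq J] (l : List (J × J)),
      l.length < n → Balanced l → IsUniversal fun N => pairSum (matrixUnit N) l)
    {l l' : List (I × I)} (h : l.Perm l') (u : List (I × I)) (hn : (u ++ l).length = n)
    (hb : Balanced (u ++ l)) (hl : IsUniversal fun N => pairSum (matrixUnit N) (u ++ l')) :
    IsUniversal fun N => pairSum (matrixUnit N) (u ++ l) := by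
  induction h generalizing u with
  | nil => exact hl
  | cons x h ihp =>
    have := ihp (u ++ [x]) (by simpa using hn) (by simpa using hb) (by simpa using hl)
    simpa using this
  | swap x y l => exact isUniversal_pairSum_swap u l y x (hn ▸ ih) hb hl
  | trans h1 h2 ih1 ih2 =>
    exact ih1 u hn hb (ih2 u (by simpa [h1.length_eq] using hn) (hb.perm (h1.append_left u)) hl)

theorem isUniversal_pairSum (n : ℕ) : ∀ (I : Type) [Fintype I] [DecidableEq I]
    (l : List (I × I)), l.length < n → Balanced l →
      IsUniversal fun N => pairSum (matrixUnit N) l := by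
  induction n with
  | zero => intro I _ _ l hl; omega
  | succ n ih =>
    intro I _ _ l hl hb
    rcases Nat.lt_succ_iff_lt_or_eq.1 hl with hl | hl
    · exact ih I l hl hb
    by_cases h0 : l = []
    · subst h0
      -- With no factors left, each free label is summed over `N` values.
      refine ⟨MvPolynomial.X 0 ^ Fintype.card I, fun N => ?_⟩
      simp [pairSum, specialize_X_zero]
    obtain ⟨k, B, hB, f, r, hr, hp⟩ := hb.exists_split h0
    have : Fintype B := Fintype.ofFinite B
    classical
    -- Sorting costs only shorter sums. The sorted sum factors as a Casimir element times a shorter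
    -- balanced sum.
    refine isUniversal_pairSum_perm ih hp [] (by simpa using hl) hb ?_
    simp only [List.nil_append, pairSum_map_equiv, pairSum_sum, pairSum_ofFn]
    refine (isUniversal_casimir k).mul (ih B r ?_ hr)
    have := hp.length_eq
    simp at this
    omega

theorem exists_isUniversalValue {m : ℕ} (α : Equiv.Perm (Fin m)) :
    ∃ p, IsUniversalValue α p := by
  obtain ⟨p, hp⟩ := isUniversal_pairSum (m + 1) (Fin m) (List.ofFn fun k => (k, α k)) (by simp)
    ⟨by
      rw [List.map_ofFn, List.map_ofFn]
      exact (Equiv.Perm.ofFn_comp_perm α id).symm, by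
      rw [List.map_ofFn]
      exact List.nodup_ofFn.2 fun _ _ h => h⟩
  exact ⟨p, fun N _ => ⟨specialize N, specialize_X_zero N, fun k hk => specialize_X N hk, by
    rw [hp]; exact pairSum_ofFn N α⟩⟩

/-- Uniqueness of the polynomial is not needed: this specialization property already determines
`Feps`, by evaluating in the twisted representations. -/
theorem universalGl_spec {m : ℕ} (α : Equiv.Perm (Fin m)) : IsUniversalValue α (universalGl α) :=
  Classical.epsilon_spec (exists_isUniversalValue α)


/-! ### The shifted standard representations -/

/-- The matrix units in the standard representation of `gl(N)` twisted by `ε` times the trace. -/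
def shiftedUnit (N : ℕ) (ε : ℂ) (i j : Fin N) : Matrix (Fin N) (Fin N) ℂ :=
  Matrix.single i j 1 + if i = j then ε • 1 else 0

theorem of_shiftedUnit (N : ℕ) (ε : ℂ) : Matrix.of (shiftedUnit N ε) =
    Matrix.of (fun i j => Matrix.single i j 1) + ε • 1 := by
  refine Matrix.ext fun i j => ?_
  rw [Matrix.add_apply, Matrix.smul_apply, Matrix.one_apply, Matrix.of_apply, Matrix.of_apply,
    shiftedUnit]
  split_ifs <;> simp

theorem shiftedUnit_zero (N : ℕ) (i j : Fin N) : shiftedUnit N 0 i j = Matrix.single i j 1 := by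
  simp [shiftedUnit]

/-- The standard representation of `gl(N)` twisted by `ε` times the trace. -/
def shiftedHom (N : ℕ) (ε : ℂ) : Matrix (Fin N) (Fin N) ℂ →ₗ⁅ℂ⁆ Matrix (Fin N) (Fin N) ℂ where
  toFun x := x + (ε * x.trace) • 1
  map_add' x y := by simp only [Matrix.trace_add, mul_add, add_smul]; abel
  map_smul' c x := by simp [smul_smul, mul_left_comm]
  map_lie' {x y} := by
    simp only [LieRing.of_associative_ring_bracket, Matrix.trace_sub, Matrix.trace_mul_comm x y]
    simp [mul_add, add_mul, mul_comm, smul_smul]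
    abel

/-- The extension of `shiftedHom` to the universal enveloping algebra. -/
def shiftedRep (N : ℕ) (ε : ℂ) : Ugl N →ₐ[ℂ] Matrix (Fin N) (Fin N) ℂ :=
  UniversalEnvelopingAlgebra.lift ℂ (shiftedHom N ε)

theorem shiftedRep_matrixUnit (N : ℕ) (ε : ℂ) (i j : Fin N) :
    shiftedRep N ε (matrixUnit N i j) = shiftedUnit N ε i j := by
  have h : shiftedRep N ε (matrixUnit N i j) = Matrix.single i j 1 +
      (ε * (Matrix.single i j (1 : ℂ)).trace) • 1 :=
    UniversalEnvelopingAlgebra.lift_ι_apply ℂ _ _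
  rw [h, shiftedUnit]
  by_cases hij : i = j
  · subst hij; simp
  · simp [hij]

theorem standardRep_matrixUnit (N : ℕ) (i j : Fin N) :
    standardRep N (matrixUnit N i j) = shiftedUnit N 0 i j := by
  rw [shiftedUnit_zero]
  exact UniversalEnvelopingAlgebra.lift_ι_apply ℂ _ _

theorem glRelations_shiftedUnit (N : ℕ) (ε : ℂ) : GlRelations (shiftedUnit N ε) := by
  intro a b c d
  have h := congrArg (shiftedRep N ε) (glRelations_matrixUnit N a b c d)
  simp only [map_sub, map_mul, shiftedRep_matrixUnit] at h
  rw [h]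
  congr 1 <;> split_ifs <;> simp [shiftedRep_matrixUnit]

theorem map_glWeight {A : Type*} [Ring A] [Algebra ℂ A] {N m : ℕ} (φ : Ugl N →ₐ[ℂ] A)
    (α : Equiv.Perm (Fin m)) : φ (glWeight N α) =
      pairSum (fun i j => φ (matrixUnit N i j)) (List.ofFn fun k => (k, α k)) := by
  simp only [pairSum, glWeight, map_sum, map_list_prod, List.map_ofFn]
  rfl

theorem shiftedRep_glWeight {N m : ℕ} (ε : ℂ) (α : Equiv.Perm (Fin m)) :
    shiftedRep N ε (glWeight N α) =
      pairSum (shiftedUnit N ε) (List.ofFn fun k => (k, α k)) := by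
  simp only [map_glWeight, shiftedRep_matrixUnit]

theorem standardRep_glWeight {N m : ℕ} (α : Equiv.Perm (Fin m)) :
    standardRep N (glWeight N α) =
      pairSum (shiftedUnit N 0) (List.ofFn fun k => (k, α k)) := by
  simp only [map_glWeight, standardRep_matrixUnit]

/-- The matrix `E` of matrix units satisfies `E² = N E`, because `∑ₓ E_ix E_xj = N E_ij`. -/
theorem pow_of_single (N k : ℕ) :
    (Matrix.of fun i j : Fin N => Matrix.single i j (1 : ℂ)) ^ (k + 1) =
      (N : ℂ) ^ k • Matrix.of fun i j : Fin N => Matrix.single i j (1 : ℂ) := by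
  induction k with
  | zero => simp
  | succ k ih =>
    rw [pow_succ, ih, smul_mul_assoc, pow_succ, mul_smul]
    congr 1
    refine Matrix.ext fun i j => ?_
    rw [Matrix.mul_apply]
    simp [Nat.cast_smul_eq_nsmul]

/-! ### Evaluation of polynomials and the action of the Casimir elements -/

/-- The evaluation of polynomials in `ℂ[N][ε]`. -/
def evalAt (x ε : ℂ) : ℂ[X][X] →ₐ[ℂ] ℂ :=
  (Polynomial.aeval x).comp
    ((Polynomial.aeval (Polynomial.C ε : ℂ[X])).restrictScalars ℂ)

theorem evalAt_C (x ε : ℂ) (p : ℂ[X]) : evalAt x ε (Polynomial.C p) = p.eval x := by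
  simp [evalAt]

theorem evalAt_varN (x ε : ℂ) : evalAt x ε varN = x := by simp [varN, evalAt_C]

theorem evalAt_varEps (x ε : ℂ) : evalAt x ε varEps = ε := by simp [varEps, evalAt]

theorem evalAt_eq (x ε : ℂ) (p : ℂ[X][X]) : evalAt x ε p = (p.eval (Polynomial.C ε)).eval x := by
  simp [evalAt]

theorem polynomial_ext {p q : ℂ[X]} (h : ∀ N : ℕ, 1 ≤ N → p.eval (N : ℂ) = q.eval (N : ℂ)) :
    p = q := by
  refine Polynomial.eq_of_infinite_eval_eq p q (Set.Infinite.mono (s := Nat.cast '' Set.Ici 1) ?_ ?_)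
  · rintro _ ⟨N, hN, rfl⟩
    exact h N hN
  · exact (Set.Ici_infinite 1).image Nat.cast_injective.injOn

theorem polynomial_ext₂ {p q : ℂ[X][X]}
    (h : ∀ N : ℕ, 1 ≤ N → ∀ ε : ℂ, evalAt N ε p = evalAt N ε q) : p = q := by
  refine Polynomial.ext fun k => polynomial_ext fun N hN => ?_
  have h1 : p.map (Polynomial.evalRingHom (N : ℂ)) = q.map (Polynomial.evalRingHom (N : ℂ)) := by
    refine Polynomial.funext fun ε => ?_
    have := h N hN ε
    rw [evalAt_eq, evalAt_eq] at this
    rw [Polynomial.map_evalRingHom_eval, Polynomial.map_evalRingHom_eval]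
    exact this
  have h2 := congrArg (Polynomial.coeff · k) h1
  simpa [Polynomial.coeff_map] using h2

/-- The binomial expansion of `(E + ε)^(k+1)` is traced term by term: the power `E^i` with `i ≥ 1`
has trace `N^(i-1)` times the identity, and `E^0` has trace `N`. -/
theorem shiftedRep_casimir (N k : ℕ) (ε : ℂ) :
    shiftedRep N ε (casimir N (k + 1)) =
      evalAt N ε (casimirSubst (k + 1)) • (1 : Matrix (Fin N) (Fin N) ℂ) := by
  have h1 : shiftedRep N ε (casimir N (k + 1)) = (Matrix.of (shiftedUnit N ε) ^ (k + 1)).trace := by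
    rw [trace_matrix_pow, casimir, shiftedRep_glWeight]
    simp only [pairSum, List.map_ofFn]
    rfl
  have hc : Commute (Matrix.of fun i j : Fin N => Matrix.single i j (1 : ℂ)) (ε • 1) :=
    (Commute.one_right _).smul_right ε
  have ht : (Matrix.of fun i j : Fin N => Matrix.single i j (1 : ℂ)).trace = 1 := by
    rw [Matrix.trace]
    exact Matrix.sum_single_one
  have hn : ∀ (x : Matrix (Fin N) (Fin N) (Matrix (Fin N) (Fin N) ℂ)) (b : ℕ),
      (x * (b : Matrix (Fin N) (Fin N) (Matrix (Fin N) (Fin N) ℂ))).trace = (b : ℂ) • x.trace := by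
    intro x b
    rw [← nsmul_eq_mul', Matrix.trace_smul, Nat.cast_smul_eq_nsmul]
  rw [h1, of_shiftedUnit, hc.add_pow, Finset.sum_range_succ', Matrix.trace_add, Matrix.trace_sum]
  simp only [pow_of_single, casimirSubst, map_add, map_sum, map_mul, map_pow, evalAt_varN,
    evalAt_varEps, map_natCast]
  rw [show Finset.Icc 1 (k + 1) = Finset.Ico 1 (k + 2) from rfl, Finset.sum_Ico_eq_sum_range,
    add_smul, Finset.sum_smul]
  congr 1
  · refine Finset.sum_congr (by simp) fun i _ => ?_
    rw [hn, smul_pow, one_pow, mul_smul_comm, mul_one, Matrix.trace_smul, Matrix.trace_smul, ht,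
      smul_smul, smul_smul, add_comm 1 i, Nat.add_sub_cancel]
    congr 1
    ring
  · rw [hn, smul_pow, one_pow, pow_zero, one_mul, Matrix.trace_smul, Matrix.trace_one,
      Fintype.card_fin, Nat.choose_zero_right, Nat.cast_one, one_smul, Nat.sub_zero,
      mul_comm (N : ℂ), mul_smul, Nat.cast_smul_eq_nsmul, nsmul_one]

/-- The twisted representation after specialization and the substitution defining `Feps` are algebra
maps which agree on all variables. -/
theorem shiftedRep_glWeight_eq {N m : ℕ} (hN : 1 ≤ N) (ε : ℂ) (α : Equiv.Perm (Fin m)) :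
    shiftedRep N ε (glWeight N α) = evalAt N ε (Feps α) • (1 : Matrix (Fin N) (Fin N) ℂ) := by
  obtain ⟨φ, h0, hk, hα⟩ := universalGl_spec α N hN
  have h : (shiftedRep N ε).comp φ = (Algebra.ofId ℂ (Matrix (Fin N) (Fin N) ℂ)).comp
      ((evalAt N ε).comp
        (MvPolynomial.aeval fun k : ℕ => if k = 0 then varN else casimirSubst k)) := by
    refine MvPolynomial.algHom_ext fun k => ?_
    rcases k with _ | k
    · simp [h0, evalAt_varN]
    · simp [hk, shiftedRep_casimir, Algebra.ofId_apply, Algebra.algebraMap_eq_smul_one]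
  have h' := DFunLike.congr_fun h (universalGl α)
  simpa [hα, Feps, Algebra.ofId_apply, Algebra.algebraMap_eq_smul_one] using h'

/-- The trace of the value of the `gl(N)` weight system in a shifted standard representation. -/
def shiftedTrace (N : ℕ) (ε : ℂ) (D : ArcDiagram) : ℂ :=
  (pairSum (shiftedUnit N ε) (List.ofFn fun k => (k, D.perm k))).trace

theorem evalAt_Feps {N : ℕ} (hN : 1 ≤ N) (ε : ℂ) (D : ArcDiagram) :
    evalAt N ε (Feps D.perm) = shiftedTrace N ε D / N := by
  have h : (N : ℂ) ≠ 0 := by exact_mod_cast (by omega : N ≠ 0)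
  rw [shiftedTrace, ← shiftedRep_glWeight, shiftedRep_glWeight_eq hN, Matrix.trace_smul,
    Matrix.trace_one, Fintype.card_fin, smul_eq_mul, mul_div_cancel_right₀ _ h]

theorem normTrace_glWeight (N : ℕ) (D : ArcDiagram) :
    normTrace N (glWeight N D.perm) = shiftedTrace N 0 D / N := by
  rw [normTrace, standardRep_glWeight, shiftedTrace]


/-! ### Sums over labellings of the chords -/

/-- An arc diagram whose arcs are named by the elements of `I` and have distinguished beginnings
and ends. -/
structure IsDecoration {I : Type} (d : List (I × Bool)) (j : I → ℕ) (D : ArcDiagram) : Prop where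
  nodup : d.Nodup
  mem : ∀ x, x ∈ d
  injective : Function.Injective j
  word_eq : D.word = d.map fun x => j x.1

/-- An orientation of each arc lets a labelling of the ends be regrouped as a labelling of chords by
matrix units. Here the Boolean records whether an end precedes its partner. -/
theorem exists_decoration (D : ArcDiagram) :
    ∃ (n : ℕ) (d : List (Fin n × Bool)) (j : Fin n → ℕ), IsDecoration d j D := by
  classical
  let e := D.word.toFinset.equivFin
  let c : Fin D.word.length → Fin D.word.toFinset.card := fun k =>
    e ⟨D.word.get k, List.mem_toFinset.2 (List.get_mem _ _)⟩
  have hc : ∀ k l, c k = c l ↔ D.word.get k = D.word.get l := by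
    intro k l
    simp only [c, e.apply_eq_iff_eq, Subtype.mk.injEq]
  have ho : ∀ k l, D.word.get k = D.word.get l → k ≠ l → D.other k = l := fun k l h h' =>
    (D.other_eq_iff k l).2 ⟨h'.symm, h.symm⟩
  refine ⟨_, List.ofFn fun k => (c k, decide (k < D.other k)), fun i => (e.symm i).1, ?_, ?_, ?_, ?_⟩
  · refine List.nodup_ofFn.2 fun k l h => ?_
    by_contra hkl
    simp only [Prod.mk.injEq, hc, decide_eq_decide] at h
    rw [ho k l h.1 hkl, ho l k h.1.symm (Ne.symm hkl)] at h
    rcases lt_or_gt_of_ne hkl with h1 | h1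
    · exact absurd (h.2.1 h1) (lt_asymm h1)
    · exact absurd (h.2.2 h1) (lt_asymm h1)
  · rintro ⟨i, s⟩
    obtain ⟨k, hk⟩ := List.mem_iff_get.1 (List.mem_toFinset.1 (e.symm i).2)
    have hck : c k = i := by
      rw [← e.apply_symm_apply i]
      simp only [c]
      congr 1
      exact Subtype.ext hk
    have h := (D.other_eq_iff k _).1 rfl
    have hoo : D.other (D.other k) = k := ho _ _ h.2 h.1
    have hco : c (D.other k) = i := by rw [← hck]; exact (hc _ _).2 h.2
    rw [List.mem_ofFn']
    rcases lt_or_gt_of_ne h.1 with h1 | h1 <;> cases s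
    · exact ⟨k, by simp [hck, h1.le]⟩
    · exact ⟨D.other k, by simp [hco, hoo, h1]⟩
    · exact ⟨D.other k, by simp [hco, hoo, h1.le]⟩
    · exact ⟨k, by simp [hck, h1]⟩
  · exact Subtype.val_injective.comp e.symm.injective
  · rw [List.map_ofFn]
    refine List.ext_get (by simp) fun k h1 h2 => ?_
    simp [c]

theorem map_update_of_ne {I P B : Type*} [DecidableEq I] (f : I → P → Bool → B)
    (l : List (I × Bool)) (g : I → P) (b : I) (x : P) (h : ∀ y ∈ l, y.1 ≠ b) :
    (l.map fun y => f y.1 (Function.update g b x y.1) y.2) = l.map fun y => f y.1 (g y.1) y.2 :=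
  List.map_congr_left fun y hy => by rw [Function.update_of_ne (h y hy)]

section

variable {A : Type*} [Ring A] {n : Type*} [Fintype n] {I : Type} [Fintype I] [DecidableEq I]

/-- The element put at one of the two ends of a chord labelled by a matrix unit. -/
def chordEnd (e : n → n → A) (x : n × n) (s : Bool) : A :=
  if s then e x.2 x.1 else e x.1 x.2

/-- The sum over the labellings of the chords by matrix units. -/
def chordSum (e : I → n → n → A) (d : List (I × Bool)) : A :=
  ∑ g : I → n × n, (d.map fun x => chordEnd (e x.1) (g x.1) x.2).prod

theorem pairSum_perm_eq_chordSum (e : n → n → A) {d : List (I × Bool)} {j : I → ℕ} {D : ArcDiagram}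
    (h : IsDecoration d j D) :
    pairSum e (List.ofFn fun k => (k, D.perm k)) = chordSum (fun _ => e) d := by
  have hl : D.word.length = d.length := by rw [h.word_eq, List.length_map]
  let f : Fin D.word.length ≃ I × Bool :=
    (finCongr hl).trans (List.Nodup.getEquivOfForallMemList d h.nodup h.mem)
  have hf : ∀ k, f k = d.get (Fin.cast hl k) := fun k => rfl
  have hg : ∀ k, D.word.get k = j (f k).1 := by
    intro k
    rw [hf]
    simp [h.word_eq]
  have hp : ∀ k, f (D.perm k) = ((f k).1, !(f k).2) := by
    intro k
    rw [← f.apply_symm_apply ((f k).1, !(f k).2)]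
    congr 1
    refine (D.other_eq_iff k _).2 ⟨fun h1 => ?_, ?_⟩
    · have h2 := congrArg f h1
      rw [f.apply_symm_apply] at h2
      have h3 := congrArg Prod.snd h2
      simp at h3
    · rw [hg, hg, f.apply_symm_apply]
  have hd : (List.ofFn fun k => (k, D.perm k)).map (Prod.map f f) =
      d.map fun x => (x, (x.1, !x.2)) := by
    rw [List.map_ofFn]
    refine List.ext_get (by simp [hl]) fun k h1 h2 => ?_
    simp only [List.get_ofFn, Function.comp_apply, Prod.map_apply, hp, hf]
    simp
  rw [← pairSum_map_equiv e f, hd, pairSum, chordSum]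
  -- The labels of the two ends of a chord are regrouped into a pair; the involution exchanges them,
  -- so opposite ends carry `E_ij` and `E_ji`.
  let F : (I → n × n) ≃ (I × Bool → n) :=
    { toFun := fun g x => if x.2 then (g x.1).2 else (g x.1).1
      invFun := fun i a => (i (a, false), i (a, true))
      left_inv := fun g => by funext a; simp
      right_inv := fun i => by
        funext x
        obtain ⟨a, s⟩ := x
        cases s <;> simp }
  rw [← F.sum_comp]
  refine Finset.sum_congr rfl fun g _ => ?_
  rw [List.map_map]
  congr 1
  refine List.map_congr_left fun x _ => ?_
  obtain ⟨a, s⟩ := x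
  cases s <;> simp [F, chordEnd]

/-- Sums over labellings may be compared by varying a single label. -/
theorem sum_eq_of_sum_update {P : Type*} [Fintype P] {V : Type*} [AddCommMonoid V]
    (H H' : (I → P) → V) (b : I)
    (h : ∀ g, ∑ x, H (Function.update g b x) = ∑ x, H' (Function.update g b x)) :
    ∑ g, H g = ∑ g, H' g := by
  rw [← (Equiv.funSplitAt b P).symm.sum_comp, ← (Equiv.funSplitAt b P).symm.sum_comp,
    Fintype.sum_prod_type_right, Fintype.sum_prod_type_right]
  refine Finset.sum_congr rfl fun g _ => ?_
  rcases isEmpty_or_nonempty P with hP | ⟨⟨p⟩⟩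
  · simp
  have e : ∀ x, (Equiv.funSplitAt b P).symm (x, g) =
      Function.update ((Equiv.funSplitAt b P).symm (p, g)) b x := by
    intro x
    funext a
    by_cases ha : a = b
    · subst ha; simp [Equiv.funSplitAt, Equiv.piSplitAt]
    · simp [Equiv.funSplitAt, Equiv.piSplitAt, ha]
  rw [Finset.sum_congr rfl fun x _ => congrArg H (e x),
    Finset.sum_congr rfl fun x _ => congrArg H' (e x)]
  exact h _

/-- Invariance of `∑ E_ij ⊗ E_ji` under `gl`, with an arbitrary element `V` between the two tensor
factors. -/
theorem sum_chordEnd_commutator [DecidableEq n] {e : n → n → A} (he : GlRelations e) (r c : n)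
    (V : A) (s : Bool) :
    ∑ x : n × n, (((e r c * chordEnd e x s - chordEnd e x s * e r c) * V * chordEnd e x (!s)) +
      chordEnd e x s * V * (e r c * chordEnd e x (!s) - chordEnd e x (!s) * e r c)) = 0 := by
  suffices h : ∑ x : n × n, (((e r c * e x.1 x.2 - e x.1 x.2 * e r c) * V * e x.2 x.1) +
      e x.1 x.2 * V * (e r c * e x.2 x.1 - e x.2 x.1 * e r c)) = 0 by
    cases s
    · simpa [chordEnd] using h
    · rw [← (Equiv.prodComm n n).sum_comp]
      simpa [chordEnd] using h
  rw [Fintype.sum_prod_type]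
  simp only [he r c, sub_mul, mul_sub, Finset.sum_add_distrib, Finset.sum_sub_distrib, ite_mul,
    mul_ite, zero_mul, mul_zero, Finset.sum_ite_eq, Finset.sum_ite_eq', Finset.mem_univ, if_true]
  have e1 : ∀ f : n → n → A, ∑ x, ∑ y, (if c = x then f x y else 0) = ∑ y, f c y := by
    intro f; rw [Finset.sum_comm]; simp
  have e2 : ∀ f : n → n → A, ∑ x, ∑ y, (if x = r then f x y else 0) = ∑ y, f r y := by
    intro f; rw [Finset.sum_comm]; simp
  simp only [e1, e2]
  abel

/-- For fixed labels of the other chords, the two differences are commutators of an end of `a` with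
the two ends of `b`; summed over the label of `b` they cancel by invariance. -/
theorem chordSum_four [DecidableEq n] {e : n → n → A} (he : GlRelations e)
    (U V W : List (I × Bool)) (a b : I) (t s : Bool) (hab : a ≠ b) (hU : ∀ y ∈ U, y.1 ≠ b)
    (hV : ∀ y ∈ V, y.1 ≠ b) (hW : ∀ y ∈ W, y.1 ≠ b) :
    (chordSum (fun _ => e) (U ++ [(a, t), (b, s)] ++ V ++ [(b, !s)] ++ W) -
      chordSum (fun _ => e) (U ++ [(b, s), (a, t)] ++ V ++ [(b, !s)] ++ W)) +
    (chordSum (fun _ => e) (U ++ [(b, s)] ++ V ++ [(a, t), (b, !s)] ++ W) -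
      chordSum (fun _ => e) (U ++ [(b, s)] ++ V ++ [(b, !s), (a, t)] ++ W)) = 0 := by
  simp only [chordSum]
  rw [← Finset.sum_sub_distrib, ← Finset.sum_sub_distrib, ← Finset.sum_add_distrib,
    ← Finset.sum_const_zero (s := (Finset.univ : Finset (I → n × n)))]
  refine sum_eq_of_sum_update _ _ b fun g => ?_
  have key : ∀ l : List (I × Bool), (∀ y ∈ l, y.1 ≠ b) → ∀ x,
      (l.map fun y => chordEnd e (Function.update g b x y.1) y.2) =
      l.map fun y => chordEnd e (g y.1) y.2 := fun l hl x =>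
    map_update_of_ne (fun _ => chordEnd e) l g b x hl
  simp only [List.map_append, List.map_cons, List.map_nil, List.prod_append, List.prod_cons,
    List.prod_nil, mul_one, key U hU, key V hV, key W hW, Function.update_self,
    Function.update_of_ne hab, Finset.sum_const_zero]
  generalize (U.map fun y => chordEnd e (g y.1) y.2).prod = u
  generalize (V.map fun y => chordEnd e (g y.1) y.2).prod = v
  generalize (W.map fun y => chordEnd e (g y.1) y.2).prod = w
  obtain ⟨r, c, hrc⟩ : ∃ r c, chordEnd e (g a) t = e r c := by
    cases t
    · exact ⟨_, _, rfl⟩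
    · exact ⟨_, _, rfl⟩
  rw [hrc]
  have h := congrArg (fun z => u * z * w) (sum_chordEnd_commutator he r c v s)
  simp only [Finset.mul_sum, Finset.sum_mul, mul_zero, zero_mul] at h
  rw [← h]
  refine Finset.sum_congr rfl fun x _ => ?_
  noncomm_ring

end


/-! ### Invariance of the weight systems -/

theorem shiftedTrace_eq {N : ℕ} {ε : ℂ} {D : ArcDiagram} {I : Type} [Fintype I] [DecidableEq I]
    {d : List (I × Bool)} {j : I → ℕ} (h : IsDecoration d j D) :
    shiftedTrace N ε D = (chordSum (fun _ => shiftedUnit N ε) d).trace := by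
  rw [shiftedTrace, pairSum_perm_eq_chordSum _ h]

theorem IsDecoration.perm {I : Type} {d d' : List (I × Bool)} {j : I → ℕ} {D D' : ArcDiagram}
    (h : IsDecoration d j D) (hd : d.Perm d') (hw : D'.word = d'.map fun x => j x.1) :
    IsDecoration d' j D' :=
  ⟨hd.nodup_iff.1 h.nodup, fun x => hd.mem_iff.1 (h.mem x), h.injective, hw⟩

theorem shiftedTrace_step (N : ℕ) (ε : ℂ) {D D' : ArcDiagram} (h : ClosureStep D D') :
    shiftedTrace N ε D = shiftedTrace N ε D' := by
  obtain ⟨n, d, j, hd⟩ := exists_decoration D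
  cases h with
  | rename f hf h =>
    have hd' : IsDecoration d (f ∘ j) D' :=
      ⟨hd.nodup, hd.mem, hf.comp hd.injective, by rw [h, hd.word_eq, List.map_map]; rfl⟩
    rw [shiftedTrace_eq hd, shiftedTrace_eq hd']
  | rotate a u h h' =>
    have hw := hd.word_eq
    rw [h] at hw
    obtain ⟨x, e, rfl, hx, he⟩ := List.map_eq_cons_iff.1 hw.symm
    have hd' : IsDecoration (e ++ [x]) j D' :=
      hd.perm (List.perm_append_singleton x e).symm (by simp [h', hx, he])
    rw [shiftedTrace_eq hd, shiftedTrace_eq hd', chordSum, chordSum, Matrix.trace_sum,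
      Matrix.trace_sum]
    refine Finset.sum_congr rfl fun g _ => ?_
    simp only [List.map_cons, List.map_append, List.prod_cons, List.prod_append, List.map_nil,
      List.prod_nil, mul_one]
    rw [Matrix.trace_mul_comm]

theorem eq_bnot_of_nodup {I : Type} {b : I} {s t : Bool} (h : (b, s) ≠ (b, t)) : t = !s := by
  cases s <;> cases t <;> simp_all

theorem shiftedTrace_four (N : ℕ) (ε : ℂ) {D₁ D₂ D₃ D₄ : ArcDiagram} {u v w : List ℕ} {a b : ℕ}
    (h₁ : D₁.word = u ++ [a, b] ++ v ++ [b] ++ w) (h₂ : D₂.word = u ++ [b, a] ++ v ++ [b] ++ w)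
    (h₃ : D₃.word = u ++ [b] ++ v ++ [a, b] ++ w) (h₄ : D₄.word = u ++ [b] ++ v ++ [b, a] ++ w) :
    (shiftedTrace N ε D₁ - shiftedTrace N ε D₂) +
      (shiftedTrace N ε D₃ - shiftedTrace N ε D₄) = 0 := by
  obtain ⟨n, d, j, hd⟩ := exists_decoration D₁
  have hw := hd.word_eq
  rw [h₁] at hw
  simp only [List.append_assoc, List.cons_append, List.nil_append] at hw
  obtain ⟨U, r₁, rfl, rfl, hr₁⟩ := List.map_eq_append_iff.1 hw.symm
  obtain ⟨⟨A, t⟩, r₂, rfl, hA, hr₂⟩ := List.map_eq_cons_iff.1 hr₁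
  obtain ⟨⟨B, s⟩, r₃, rfl, hB, hr₃⟩ := List.map_eq_cons_iff.1 hr₂
  obtain ⟨V, r₄, rfl, rfl, hr₄⟩ := List.map_eq_append_iff.1 hr₃
  obtain ⟨⟨B', s'⟩, W, rfl, hB', rfl⟩ := List.map_eq_cons_iff.1 hr₄
  obtain rfl : B = B' := hd.injective (by simpa using hB.trans hB'.symm)
  have hnd := hd.nodup
  -- A decoration lists every chord end once, so the two occurrences of `B` are its two different
  -- ends.
  obtain rfl : s' = !s := by
    refine eq_bnot_of_nodup (b := B) fun h => ?_
    rw [h] at hnd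
    have h1 := List.nodup_iff_count_le_one.1 hnd (B, s')
    simp [List.count_append, List.count_cons] at h1
    omega
  have hne : ∀ y : Fin n × Bool, y.1 = B → y = (B, s) ∨ y = (B, !s) := by
    rintro ⟨y, t'⟩ rfl
    cases t' <;> cases s <;> simp
  have hu : ∀ y, y.1 = B → y ∉ U ∧ y ∉ V ∧ y ∉ W ∧ y ≠ (A, t) := by
    intro y hy
    have h1 : ∀ z, _ := List.nodup_iff_count_le_one.1 hnd
    rcases hne y hy with rfl | rfl
    · have h2 := h1 (B, s)
      simp only [List.count_append, List.count_cons, beq_self_eq_true, if_true] at h2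
      refine ⟨List.count_eq_zero.1 (by omega), List.count_eq_zero.1 (by omega),
        List.count_eq_zero.1 (by omega), fun h => ?_⟩
      rw [h] at h2
      simp at h2
      omega
    · have h2 := h1 (B, !s)
      simp only [List.count_append, List.count_cons, beq_self_eq_true, if_true] at h2
      refine ⟨List.count_eq_zero.1 (by omega), List.count_eq_zero.1 (by omega),
        List.count_eq_zero.1 (by omega), fun h => ?_⟩
      rw [h] at h2
      simp at h2
      omega
  have hAB : A ≠ B := fun h => (hu (A, t) h).2.2.2 rfl
  have hU : ∀ y ∈ U, y.1 ≠ B := fun y hy h => (hu y h).1 hy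
  have hV : ∀ y ∈ V, y.1 ≠ B := fun y hy h => (hu y h).2.1 hy
  have hW : ∀ y ∈ W, y.1 ≠ B := fun y hy h => (hu y h).2.2.1 hy
  have e₁ : IsDecoration (U ++ [(A, t), (B, s)] ++ V ++ [(B, !s)] ++ W) j D₁ :=
    hd.perm (List.Perm.of_eq (by simp)) (by simp [h₁, ← hA, ← hB])
  have e₂ : IsDecoration (U ++ [(B, s), (A, t)] ++ V ++ [(B, !s)] ++ W) j D₂ := by
    refine e₁.perm ?_ (by simp [h₂, ← hA, ← hB])
    rw [List.perm_iff_count]; intro x; simp only [List.count_append, List.count_cons]; omega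
  have e₃ : IsDecoration (U ++ [(B, s)] ++ V ++ [(A, t), (B, !s)] ++ W) j D₃ := by
    refine e₁.perm ?_ (by simp [h₃, ← hA, ← hB])
    rw [List.perm_iff_count]; intro x; simp only [List.count_append, List.count_cons]; omega
  have e₄ : IsDecoration (U ++ [(B, s)] ++ V ++ [(B, !s), (A, t)] ++ W) j D₄ := by
    refine e₁.perm ?_ (by simp [h₄, ← hA, ← hB])
    rw [List.perm_iff_count]; intro x; simp only [List.count_append, List.count_cons]; omega
  rw [shiftedTrace_eq e₁, shiftedTrace_eq e₂, shiftedTrace_eq e₃, shiftedTrace_eq e₄,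
    ← Matrix.trace_sub, ← Matrix.trace_sub, ← Matrix.trace_add,
    chordSum_four (glRelations_shiftedUnit N ε) U V W A B t s hAB hU hV hW, Matrix.trace_zero]

/-! ### Expansion of the shifted weight system -/

theorem exists_eq_append_of_mem {I : Type} {d : List (I × Bool)} {b : I}
    (hd : d.Nodup) (h : ∀ s, (b, s) ∈ d) :
    ∃ (U V W : List (I × Bool)) (s : Bool), d = U ++ [(b, s)] ++ V ++ [(b, !s)] ++ W ∧
      ∀ y ∈ U ++ V ++ W, y.1 ≠ b := by
  classical
  obtain ⟨s, X, Y, rfl, hX⟩ : ∃ (s : Bool) (X Y : List (I × Bool)), d = X ++ (b, s) :: Y ∧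
      (b, !s) ∈ Y := by
    obtain ⟨X, Y, rfl⟩ := List.append_of_mem (h true)
    have h1 := h false
    rw [List.mem_append, List.mem_cons] at h1
    rcases h1 with h1 | h1 | h1
    · obtain ⟨X₁, X₂, rfl⟩ := List.append_of_mem h1
      exact ⟨false, X₁, X₂ ++ (b, true) :: Y, by simp, by simp⟩
    · simp at h1
    · exact ⟨true, X, Y, rfl, h1⟩
  obtain ⟨V, W, rfl⟩ := List.append_of_mem hX
  refine ⟨X, V, W, s, by simp, ?_⟩
  rintro ⟨y, t⟩ hy rfl
  have h1 := List.nodup_iff_count_le_one.1 hd (y, t)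
  have h2 := List.count_pos_iff.2 hy
  simp only [List.count_append, List.count_cons] at h1 h2
  by_cases hst : t = s
  · subst hst; simp at h1; omega
  · obtain rfl : t = !s := by cases s <;> cases t <;> simp_all
    simp at h1; omega

section

variable {A : Type*} [Ring A] [Algebra ℂ A] {n : Type*} [Fintype n] [DecidableEq n]

/-- The matrix units twisted by `ε` times the trace. -/
def shift (e : n → n → A) (ε : ℂ) (i j : n) : A := e i j + if i = j then ε • 1 else 0

/-- The cross terms give `ε V` twice since `∑ e_ii = 1`, and the scalar parts on the diagonal give
`N ε² V`. -/
theorem sum_chordEnd_shift {e : n → n → A} (he : ∑ i, e i i = 1) (ε : ℂ) (V : A) (s : Bool) :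
    ∑ x : n × n, chordEnd (shift e ε) x s * V * chordEnd (shift e ε) x (!s) =
      ∑ x : n × n, chordEnd e x s * V * chordEnd e x (!s) +
        (2 * ε + Fintype.card n * ε ^ 2) • V := by
  suffices h : ∑ x : n × n, shift e ε x.1 x.2 * V * shift e ε x.2 x.1 =
      ∑ x : n × n, e x.1 x.2 * V * e x.2 x.1 + (2 * ε + Fintype.card n * ε ^ 2) • V by
    cases s
    · simpa [chordEnd] using h
    · rw [← (Equiv.prodComm n n).sum_comp, ← (Equiv.prodComm n n).sum_comp
        (fun x => chordEnd e x true * V * chordEnd e x (!true))]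
      simpa [chordEnd] using h
  have h1 : ∀ i j : n, shift e ε i j * V * shift e ε j i = e i j * V * e j i +
      if i = j then ε • (e i i * V) + ε • (V * e i i) + (ε ^ 2) • V else 0 := by
    intro i j
    by_cases hij : i = j
    · subst hij
      simp only [shift, if_true, add_mul, mul_add, smul_mul_assoc, mul_smul_comm, one_mul, mul_one,
        smul_add, smul_smul, pow_two]
      abel
    · simp [shift, hij, Ne.symm hij]
  have h2 : ∑ i, (ε • (e i i * V) + ε • (V * e i i) + (ε ^ 2) • V) =
      (2 * ε + Fintype.card n * ε ^ 2) • V := by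
    rw [Finset.sum_add_distrib, Finset.sum_add_distrib, ← Finset.smul_sum, ← Finset.smul_sum,
      ← Finset.sum_mul, ← Finset.mul_sum, he, one_mul, mul_one, Finset.sum_const, Finset.card_univ,
      add_smul, mul_smul (Fintype.card n : ℂ), Nat.cast_smul_eq_nsmul, two_mul, add_smul]
  rw [Fintype.sum_prod_type, Fintype.sum_prod_type]
  simp only [h1, Finset.sum_add_distrib (f := fun j => e _ j * V * e j _)]
  rw [Finset.sum_add_distrib, ← h2]
  simp

variable {I : Type} [Fintype I] [DecidableEq I]

/-- The family which is twisted at the chords of a given set. -/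
def shiftOn (e : n → n → A) (ε : ℂ) (T : Finset I) (a : I) : n → n → A :=
  if a ∈ T then shift e ε else e

/-- Twisting one more chord adds a multiple of the sum with that chord deleted. The deleted chord
keeps a free label with `N²` values, which explains the denominator. -/
theorem chordSum_shiftOn_insert [Nonempty n] {e : n → n → A} (he : ∑ i, e i i = 1) (ε : ℂ)
    {T : Finset I} {b : I} (hb : b ∉ T) {d : List (I × Bool)} (hd : d.Nodup)
    (h : ∀ s, (b, s) ∈ d) :
    chordSum (shiftOn e ε (insert b T)) d = chordSum (shiftOn e ε T) d +
      ((2 * ε + Fintype.card n * ε ^ 2) / (Fintype.card n : ℂ) ^ 2) •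
        chordSum (shiftOn e ε T) (d.filter (·.1 ≠ b)) := by
  obtain ⟨U, V, W, s, rfl, hne⟩ := exists_eq_append_of_mem hd h
  have hU : ∀ y ∈ U, y.1 ≠ b := fun y hy => hne y (by simp [hy])
  have hV : ∀ y ∈ V, y.1 ≠ b := fun y hy => hne y (by simp [hy])
  have hW : ∀ y ∈ W, y.1 ≠ b := fun y hy => hne y (by simp [hy])
  have hfilter : (U ++ [(b, s)] ++ V ++ [(b, !s)] ++ W).filter (·.1 ≠ b) = U ++ V ++ W := by
    have hf : ∀ l : List (I × Bool), (∀ y ∈ l, y.1 ≠ b) → l.filter (·.1 ≠ b) = l :=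
      fun l hl => List.filter_eq_self.2 fun y hy => by simpa using hl y hy
    simp only [List.filter_append, hf U hU, hf V hV, hf W hW]
    simp
  rw [hfilter]
  simp only [chordSum]
  rw [Finset.smul_sum, ← Finset.sum_add_distrib]
  refine sum_eq_of_sum_update _ _ b fun g => ?_
  have key : ∀ l : List (I × Bool), (∀ y ∈ l, y.1 ≠ b) → ∀ x,
      (l.map fun y => chordEnd (shiftOn e ε T y.1) (Function.update g b x y.1) y.2) =
      l.map fun y => chordEnd (shiftOn e ε T y.1) (g y.1) y.2 := fun l hl x =>
    map_update_of_ne (fun a => chordEnd (shiftOn e ε T a)) l g b x hl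
  have key' : ∀ l : List (I × Bool), (∀ y ∈ l, y.1 ≠ b) → ∀ x,
      (l.map fun y => chordEnd (shiftOn e ε (insert b T) y.1) (Function.update g b x y.1) y.2) =
      l.map fun y => chordEnd (shiftOn e ε T y.1) (g y.1) y.2 := by
    intro l hl x
    rw [map_update_of_ne (fun a => chordEnd (shiftOn e ε (insert b T) a)) l g b x hl]
    exact List.map_congr_left fun y hy => by simp [shiftOn, hl y hy]
  have e1 : shiftOn e ε (insert b T) b = shift e ε := by simp [shiftOn]
  have e2 : shiftOn e ε T b = e := by simp [shiftOn, hb]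
  simp only [List.map_append, List.map_cons, List.map_nil, List.prod_append, List.prod_cons,
    List.prod_nil, mul_one, key U hU, key V hV, key W hW, key' U hU, key' V hV, key' W hW,
    Function.update_self, e1, e2]
  generalize (U.map fun y => chordEnd (shiftOn e ε T y.1) (g y.1) y.2).prod = u
  generalize (V.map fun y => chordEnd (shiftOn e ε T y.1) (g y.1) y.2).prod = v
  generalize (W.map fun y => chordEnd (shiftOn e ε T y.1) (g y.1) y.2).prod = w
  have h := congrArg (fun z => u * z * w) (sum_chordEnd_shift he ε v s)
  simp only [Finset.mul_sum, Finset.sum_mul, mul_add, add_mul] at h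
  have hc : (Fintype.card n : ℂ) ≠ 0 := by exact_mod_cast Fintype.card_ne_zero
  rw [Finset.sum_add_distrib, Finset.sum_const, Finset.card_univ, Fintype.card_prod,
    ← Nat.cast_smul_eq_nsmul ℂ, smul_smul, Nat.cast_mul, ← pow_two, mul_div_cancel₀ _ (pow_ne_zero 2 hc)]
  simp only [mul_assoc, mul_smul_comm, smul_mul_assoc] at h ⊢
  exact h

theorem chordSum_shiftOn [Nonempty n] {e : n → n → A} (he : ∑ i, e i i = 1) (ε : ℂ)
    (T : Finset I) (d : List (I × Bool)) (hd : d.Nodup) (h : ∀ b ∈ T, ∀ s, (b, s) ∈ d) :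
    chordSum (shiftOn e ε T) d = ∑ S ∈ T.powerset,
      ((2 * ε + Fintype.card n * ε ^ 2) / (Fintype.card n : ℂ) ^ 2) ^ S.card •
        chordSum (fun _ => e) (d.filter (·.1 ∉ S)) := by
  induction T using Finset.induction_on generalizing d with
  | empty =>
    have : shiftOn e ε (∅ : Finset I) = fun _ => e := by funext a; simp [shiftOn]
    simp [this]
  | insert b T hb ih =>
    rw [chordSum_shiftOn_insert he ε hb hd (h b (Finset.mem_insert_self b T)),
      Finset.sum_powerset_insert hb, ih d hd fun a ha => h a (Finset.mem_insert_of_mem ha),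
      ih (d.filter (·.1 ≠ b)) (hd.filter _) ?_, Finset.smul_sum]
    · congr 1
      refine Finset.sum_congr rfl fun S hS => ?_
      have hbS : b ∉ S := fun h => hb (Finset.mem_powerset.1 hS h)
      rw [Finset.card_insert_of_notMem hbS, pow_succ' (_ / _) S.card, mul_smul (_ / _),
        List.filter_filter]
      congr 3
      refine List.filter_congr fun x _ => ?_
      by_cases hx : x.1 = b <;> simp [hx]
    · intro a ha s
      refine List.mem_filter.2 ⟨h a (Finset.mem_insert_of_mem ha) s, ?_⟩
      simpa using fun hab : a = b => hb (hab ▸ ha)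

end

/-- Each deleted chord has `N²` free labels; these powers cancel the denominators of
`chordSum_shiftOn`. -/
theorem chordSum_subtype {A : Type*} [Ring A] [Algebra ℂ A] {n : Type*} [Fintype n] {I : Type}
    [Fintype I] [DecidableEq I] (e : n → n → A) (S : Finset I) (d : List ({a // a ∉ S} × Bool)) :
    chordSum (fun _ => e) (d.map fun x => (x.1.1, x.2)) =
      (((Fintype.card n : ℂ) ^ 2) ^ S.card) • chordSum (fun _ => e) d := by
  simp only [chordSum, List.map_map, Function.comp_def]
  rw [← (Equiv.piEquivPiSubtypeProd (fun a => a ∉ S) fun _ => n × n).symm.sum_comp,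
    Fintype.sum_prod_type, Finset.smul_sum]
  refine Finset.sum_congr rfl fun g _ => ?_
  have e1 : ∀ (g' : {a // ¬a ∉ S} → n × n) (a : {a // a ∉ S}),
      (Equiv.piEquivPiSubtypeProd (fun a => a ∉ S) fun _ => n × n).symm (g, g') a.1 = g a := by
    intro g' a
    simp [Equiv.piEquivPiSubtypeProd, a.2]
  simp only [e1]
  rw [Finset.sum_const, Finset.card_univ, ← Nat.cast_smul_eq_nsmul ℂ]
  congr 1
  rw [Fintype.card_fun, Fintype.card_prod]
  have : Fintype.card {a // ¬a ∉ S} = S.card := by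
    rw [← Fintype.card_coe]
    exact Fintype.card_congr (Equiv.subtypeEquivRight fun a => not_not)
  rw [this]
  push_cast
  ring

theorem IsDecoration.word_toFinset {I : Type} [Fintype I] [DecidableEq I] {d : List (I × Bool)}
    {j : I → ℕ} {D : ArcDiagram} (h : IsDecoration d j D) :
    D.word.toFinset = Finset.univ.image j := by
  ext x
  rw [h.word_eq]
  simp only [List.mem_toFinset, List.mem_map, Finset.mem_image, Finset.mem_univ, true_and]
  exact ⟨fun ⟨y, _, hy⟩ => ⟨y.1, hy⟩, fun ⟨a, ha⟩ => ⟨(a, true), h.mem _, ha⟩⟩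

theorem IsDecoration.restrict {I : Type} [Fintype I] [DecidableEq I] {d : List (I × Bool)}
    {j : I → ℕ} {D : ArcDiagram} (h : IsDecoration d j D) (S : Finset I) :
    ∃ d' : List ({a // a ∉ S} × Bool), d'.map (fun x => (x.1.1, x.2)) = d.filter (·.1 ∉ S) ∧
      IsDecoration d' (fun a => j a.1) (D.restrict (Sᶜ.image j)) := by
  have hinj : Function.Injective fun x : {a // a ∉ S} × Bool => (x.1.1, x.2) := by
    rintro ⟨⟨a, ha⟩, s⟩ ⟨⟨b, hb⟩, t⟩ h
    simpa using h
  have hr : d.filter (·.1 ∉ S) ∈ Set.range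
      (List.map fun x : {a // a ∉ S} × Bool => (x.1.1, x.2)) := by
    rw [Set.range_list_map]
    intro x hx
    have := (List.mem_filter.1 hx).2
    exact ⟨(⟨x.1, by simpa using this⟩, x.2), rfl⟩
  obtain ⟨d', hd'⟩ := hr
  refine ⟨d', hd', ?_, ?_, ?_, ?_⟩
  · exact List.Nodup.of_map _ (hd' ▸ h.nodup.filter _)
  · intro x
    have : (x.1.1, x.2) ∈ d.filter (·.1 ∉ S) :=
      List.mem_filter.2 ⟨h.mem _, by simpa using x.1.2⟩
    rw [← hd'] at this
    obtain ⟨y, hy, hxy⟩ := List.mem_map.1 this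
    rwa [← hinj hxy]
  · exact h.injective.comp Subtype.val_injective
  · have e : (d'.map fun x => j x.1.1) = (d.filter (·.1 ∉ S)).map fun x => j x.1 := by
      rw [← hd', List.map_map]; rfl
    rw [e]
    simp only [ArcDiagram.restrict, h.word_eq, List.filter_map]
    congr 1
    refine List.filter_congr fun x _ => ?_
    simp [h.injective.eq_iff]

theorem shiftedTrace_expand {N : ℕ} (hN : 1 ≤ N) (ε : ℂ) (D : ArcDiagram) :
    shiftedTrace N ε D = ∑ R ∈ D.word.toFinset.powerset, shiftedTrace N 0 (D.restrict R) *
      (2 * ε + N * ε ^ 2) ^ ((D.restrict (D.word.toFinset \ R)).word.length / 2) := by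
  have : Nonempty (Fin N) := ⟨⟨0, hN⟩⟩
  have hN0 : (N : ℂ) ≠ 0 := by exact_mod_cast (by omega : N ≠ 0)
  obtain ⟨m, d, j, h⟩ := exists_decoration D
  have he : ∑ i, shiftedUnit N 0 i i = 1 := by
    simp only [shiftedUnit_zero]
    exact Matrix.sum_single_one
  have hs : (fun _ => shiftedUnit N ε) =
      shiftOn (shiftedUnit N 0) ε (Finset.univ : Finset (Fin m)) := by
    funext a i k
    simp [shiftOn, shift, shiftedUnit]
  -- `chordSum_shiftOn` indexes the terms by the set of deleted chords; passing to complements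
  -- indexes them by the kept ones.
  rw [h.word_toFinset, Finset.powerset_image, Finset.sum_image fun S _ T _ hST =>
    Finset.image_injective h.injective hST, shiftedTrace_eq h, hs,
    chordSum_shiftOn he ε _ d h.nodup (fun _ _ _ => h.mem _), Matrix.trace_sum,
    Finset.powerset_univ,
    ← Equiv.sum_comp (compl_involutive.toPerm (compl : Finset (Fin m) → _))]
  refine Finset.sum_congr rfl fun S _ => ?_
  obtain ⟨d', hd', h'⟩ := h.restrict Sᶜ
  have hl : Finset.univ.image j \ S.image j = Sᶜ.image j := by
    rw [← Finset.image_sdiff _ _ h.injective, Finset.compl_eq_univ_sdiff]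
  have hS : Sᶜ.image j ⊆ D.word.toFinset := by
    rw [h.word_toFinset]
    exact Finset.image_subset_image (Finset.subset_univ _)
  rw [compl_compl] at h'
  rw [Function.Involutive.coe_toPerm, ← hd', chordSum_subtype, hl, length_word_restrict D hS,
    shiftedTrace_eq h', Nat.mul_div_cancel_left _ two_pos, Finset.card_image_of_injective _ h.injective,
    smul_smul, ← mul_pow, Fintype.card_fin, div_mul_cancel₀ _ (pow_ne_zero 2 hN0),
    Matrix.trace_smul, smul_eq_mul, mul_comm]


/-! ### The weight systems on primitive elements -/

theorem exists_isFeps : ∃ G : ChordSpace →ₗ[ℂ] ℂ[X][X], IsFeps G := by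
  refine exists_lift (fun D => Feps D.perm) (fun D E h => ?_) fun D₁ D₂ D₃ D₄ u v w a b h₁ h₂ h₃ h₄ => ?_
  · refine polynomial_ext₂ fun N hN ε => ?_
    rw [evalAt_Feps hN, evalAt_Feps hN, shiftedTrace_step N ε h]
  · refine polynomial_ext₂ fun N hN ε => ?_
    simp only [map_add, map_sub, map_zero, evalAt_Feps hN, ← sub_div, ← add_div,
      shiftedTrace_four N ε h₁ h₂ h₃ h₄, zero_div]

theorem existsUnique_isFeps : ∃! G : ChordSpace →ₗ[ℂ] ℂ[X][X], IsFeps G := by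
  obtain ⟨G, hG⟩ := exists_isFeps
  exact ⟨G, hG, fun G' hG' => lin_ext fun D => by rw [hG, hG']⟩

/-- At `ε = 0` the twisted representation is the standard one, so `F` is the constant term of `F_ε`
in `ε`; this also gives polynomiality in `N`. -/
theorem existsUnique_isF : ∃! G : ChordSpace →ₗ[ℂ] ℂ[X], IsF G := by
  obtain ⟨G, hG⟩ := exists_isFeps
  refine ⟨((Polynomial.aeval (0 : ℂ[X])).restrictScalars ℂ).toLinearMap ∘ₗ G, ?_, ?_⟩
  · intro D N hN
    rw [normTrace_glWeight, ← evalAt_Feps hN, evalAt_eq, ← hG D, map_zero]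
    simp
  · intro G' hG'
    refine lin_ext fun D => polynomial_ext fun N hN => ?_
    rw [hG' D N hN, normTrace_glWeight, ← evalAt_Feps hN, evalAt_eq, ← hG D, map_zero]
    simp

/-! ### Convolution and its values on primitive elements -/

section Convolution

variable {R : Type*} [CommRing R] [Algebra ℂ R] (f g : ChordSpace →ₗ[ℂ] R)

/-- The convolution of two linear maps. -/
def convolution : ChordSpace →ₗ[ℂ] R := LinearMap.mul' ℂ R ∘ₗ TensorProduct.map f g ∘ₗ comul

theorem convolution_cls (D : ArcDiagram) : convolution f g D.close.cls =
    ∑ S ∈ D.word.toFinset.powerset, f (D.restrict S).close.cls *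
      g (D.restrict (D.word.toFinset \ S)).close.cls := by
  simp [convolution, comul_cls, ArcDiagram.split]

theorem convolution_primitive {x : ChordSpace} (hx : x ∈ primitives) :
    convolution f g x = f 1 * g x + f x * g 1 := by
  simp [convolution, mem_primitives.1 hx]

end Convolution

theorem chordGenerating_restrict (D : ArcDiagram) {S : Finset ℕ} (hS : S ⊆ D.word.toFinset) :
    chordGenerating (D.restrict S).close.cls = Polynomial.X ^ S.card := by
  rw [chordGenerating_cls, length_word_restrict D hS, Nat.mul_div_cancel_left _ two_pos]

/-- By the binomial theorem over subsets of chords, the maps `s^n` and `t^n` convolve to `(s +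
t)^n`; on primitives convolution becomes addition. -/
theorem eval_chordGenerating_add {x : ChordSpace} (hx : x ∈ primitives) (s t : ℂ) :
    (chordGenerating x).eval (s + t) = (chordGenerating x).eval s + (chordGenerating x).eval t := by
  let ev : ℂ → ChordSpace →ₗ[ℂ] ℂ := fun s => Polynomial.leval s ∘ₗ chordGenerating
  have h : convolution (ev s) (ev t) = ev (s + t) := by
    refine lin_ext fun D => ?_
    rw [convolution_cls]
    simp only [ev, LinearMap.comp_apply, Polynomial.leval_apply, chordGenerating_cls D,
      length_word_eq D, Nat.mul_div_cancel_left _ two_pos]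
    rw [Polynomial.eval_pow, Polynomial.eval_X, ← Finset.sum_pow_mul_eq_add_pow]
    refine Finset.sum_congr rfl fun S hS => ?_
    rw [Finset.mem_powerset] at hS
    rw [chordGenerating_restrict D hS, chordGenerating_restrict D Finset.sdiff_subset,
      Finset.card_sdiff_of_subset hS]
    simp
  have h1 : convolution (ev s) (ev t) x = ev (s + t) x := by rw [h]
  rw [convolution_primitive _ _ hx] at h1
  simp only [ev, LinearMap.comp_apply, Polynomial.leval_apply, chordGenerating_one,
    Polynomial.eval_one, one_mul, mul_one] at h1
  rw [← h1, add_comm]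

/-- Additivity `p(t + s) = p(t) + p(s)`, differentiated in `t` at 0, gives `p'(s) = p'(0)`, which is
the linear coefficient. -/
theorem chordGenerating_eq_zero {x : ChordSpace} (hx : x ∈ primitives)
    (h1 : (chordGenerating x).coeff 1 = 0) : chordGenerating x = 0 := by
  set p := chordGenerating x with hp
  have hc : ∀ s, p.comp (Polynomial.X + Polynomial.C s) = p + Polynomial.C (p.eval s) := by
    intro s
    refine Polynomial.funext fun t => ?_
    simp [hp, eval_chordGenerating_add hx]
  have hd : Polynomial.derivative p = 0 := by
    refine Polynomial.funext fun s => ?_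
    have h2 := congrArg (fun q => (Polynomial.derivative q).eval 0) (hc s)
    simp only [Polynomial.derivative_comp, Polynomial.derivative_add, Polynomial.derivative_C,
      Polynomial.derivative_X, add_zero, one_mul, Polynomial.eval_comp, Polynomial.eval_add,
      Polynomial.eval_X, Polynomial.eval_C, zero_add] at h2
    rw [h2, ← Polynomial.coeff_zero_eq_eval_zero, Polynomial.coeff_derivative, h1]
    simp
  rw [Polynomial.eq_C_of_derivative_eq_zero hd, hp, coeff_zero_of_primitive hx, map_zero]

/-- Twisting by the trace amounts to replacing some of the chords by the factor `2 ε + N ε ^ 2`. -/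
theorem isFeps_eq_convolution {Fε : ChordSpace →ₗ[ℂ] ℂ[X][X]} {F : ChordSpace →ₗ[ℂ] ℂ[X]}
    (hFε : IsFeps Fε) (hF : IsF F) :
    Fε = convolution ((Polynomial.CAlgHom (R := ℂ) (A := ℂ[X])).toLinearMap ∘ₗ F)
      ((Polynomial.aeval (2 * varEps + varN * varEps ^ 2)).toLinearMap ∘ₗ chordGenerating) := by
  refine lin_ext fun D => polynomial_ext₂ fun N hN ε => ?_
  rw [hFε, evalAt_Feps hN, shiftedTrace_expand hN, convolution_cls, map_sum, Finset.sum_div]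
  refine Finset.sum_congr rfl fun S hS => ?_
  simp only [LinearMap.comp_apply, chordGenerating_cls]
  have e1 : evalAt N ε (Polynomial.C (F (D.restrict S).close.cls)) =
      shiftedTrace N 0 (D.restrict S) / N := by
    rw [evalAt_C, hF _ N hN, normTrace_glWeight]
  have e2 : evalAt N ε (2 * varEps + varN * varEps ^ 2) = 2 * ε + N * ε ^ 2 := by
    rw [map_add, map_mul, map_mul, map_pow, map_ofNat, evalAt_varN, evalAt_varEps]
  rw [map_mul]
  simp only [AlgHom.toLinearMap_apply, map_pow, Polynomial.aeval_X, e2]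
  rw [mul_div_right_comm]
  congr 1
  exact e1.symm

theorem isF_one {F : ChordSpace →ₗ[ℂ] ℂ[X]} (hF : IsF F) : F 1 = 1 := by
  refine polynomial_ext fun N hN => ?_
  have hN0 : (N : ℂ) ≠ 0 := by exact_mod_cast (by omega : N ≠ 0)
  have h : glWeight N ArcDiagram.empty.perm = 1 := by
    change ∑ i : Fin 0 → Fin N, (List.ofFn fun k : Fin 0 => _).prod = _
    simp
  rw [← unit_eq_one, unit, hF _ N hN, normTrace, h]
  simp [hN0]

/-- The unit counts as `X^0`, and a product of two nonempty diagrams has at least two chords. -/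
theorem coeff_one_of_decomposable {x : ChordSpace} (hx : x ∈ decomposables) :
    (chordGenerating x).coeff 1 = 0 := by
  obtain ⟨c, n, y, hy, rfl⟩ := exists_of_mem_decomposables hx
  rw [map_add, map_smul, Polynomial.coeff_add, coeff_chordGenerating hy one_lt_two,
    chordGenerating_one, Polynomial.coeff_smul, Polynomial.coeff_one]
  simp

theorem isFeps_primitive {Fε : ChordSpace →ₗ[ℂ] ℂ[X][X]} {F : ChordSpace →ₗ[ℂ] ℂ[X]}
    (hFε : IsFeps Fε) (hF : IsF F) {x : ChordSpace} (hx : x ∈ primitives) :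
    Fε x = Polynomial.C (F x) +
      Polynomial.aeval (2 * varEps + varN * varEps ^ 2) (chordGenerating x) := by
  rw [isFeps_eq_convolution hFε hF, convolution_primitive _ _ hx]
  simp [isF_one hF, chordGenerating_one]
  rw [add_comm]

theorem exists_word_of_numChords_eq_one (D : ArcDiagram) (h : D.close.numChords = 1) :
    ∃ a, D.word = [a, a] := by
  have h1 : D.word.length / 2 = 1 := h
  rw [length_word_eq] at h1
  have h2 : D.word.length = 2 := by rw [length_word_eq]; omega
  obtain ⟨a, b, hab⟩ := List.length_eq_two.1 h2
  have h3 := D.count_eq_two a (by simp [hab])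
  rw [hab] at h3
  by_cases hba : b = a
  · exact ⟨a, by rw [hab, hba]⟩
  · simp [hba] at h3

theorem primitive_of_oneChord (D : ArcDiagram) {a : ℕ} (h : D.word = [a, a]) :
    D.close.cls ∈ primitives := by
  have hL : D.word.toFinset = {a} := by simp [h]
  have hfull : (D.restrict {a}).close.cls = D.close.cls :=
    congrArg _ (close_eq_of_word (by simp [ArcDiagram.restrict, h]))
  have hempty : (D.restrict ∅).close.cls = 1 := cls_eq_one _ (by simp [ArcDiagram.restrict])
  rw [mem_primitives, comul_cls, ArcDiagram.split, hL, show ({a} : Finset ℕ).powerset = {∅, {a}} from rfl,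
    Finset.sum_pair (Finset.singleton_ne_empty a).symm]
  simp [hfull, hempty]

theorem isF_oneChord {F : ChordSpace →ₗ[ℂ] ℂ[X]} (hF : IsF F) (D : ArcDiagram) {a : ℕ}
    (h : D.word = [a, a]) : F D.close.cls = Polynomial.X := by
  refine polynomial_ext fun N hN => ?_
  have hN0 : (N : ℂ) ≠ 0 := by exact_mod_cast (by omega : N ≠ 0)
  have hd : IsDecoration [((0 : Fin 1), false), (0, true)] (fun _ => a) D :=
    ⟨by decide, by decide, Function.injective_of_subsingleton _, by simp [h]⟩
  rw [hF D N hN, normTrace_glWeight, shiftedTrace_eq hd, chordSum,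
    ← (Equiv.funUnique (Fin 1) (Fin N × Fin N)).symm.sum_comp, Matrix.trace_sum]
  simp [chordEnd, shiftedUnit_zero, hN0]

end ChordHopf

/-! ### The theorem -/

theorem mainTheorem5 :
    (∃! π : ChordHopf.ChordSpace →ₗ[ℂ] ChordHopf.ChordSpace,
      ChordHopf.IsPrimitiveProjection π) ∧
    (∃! Fε : ChordHopf.ChordSpace →ₗ[ℂ] ℂ[X][X], ChordHopf.IsFeps Fε) ∧
    (∃! F : ChordHopf.ChordSpace →ₗ[ℂ] ℂ[X], ChordHopf.IsF F) ∧
    ∀ (π : ChordHopf.ChordSpace →ₗ[ℂ] ChordHopf.ChordSpace)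
      (Fε : ChordHopf.ChordSpace →ₗ[ℂ] ℂ[X][X]) (F : ChordHopf.ChordSpace →ₗ[ℂ] ℂ[X]),
      ChordHopf.IsPrimitiveProjection π → ChordHopf.IsFeps Fε → ChordHopf.IsF F →
      (∀ B : ChordHopf.ChordDiagram, 2 ≤ B.numChords →
        (∃ q : ℂ[X], Fε (π B.cls) = Polynomial.C q) ∧
        Fε (π B.cls) = Polynomial.C (F (π B.cls))) ∧
      (∀ B : ChordHopf.ChordDiagram, B.numChords = 1 →
        Fε (π B.cls) = Fε B.cls ∧
        Fε B.cls = ChordHopf.varN + 2 * ChordHopf.varEps +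
          ChordHopf.varN * ChordHopf.varEps ^ 2) := by
  refine ⟨ChordHopf.existsUnique_primitiveProjection, ChordHopf.existsUnique_isFeps,
    ChordHopf.existsUnique_isF, fun π Fε F hπ hFε hF => ⟨fun B hB => ?_, fun B hB => ?_⟩⟩
  · have hp := hπ.1.map_mem B.cls
    -- The diagram and its projection have the same linear coefficient; for at least two chords it
    -- is 0, so the correction term vanishes.
    have hd : B.cls - π B.cls ∈ ChordHopf.decomposables := by
      rw [← hπ.2, LinearMap.mem_ker, map_sub, hπ.1.map_id _ hp, sub_self]
    have h1 := ChordHopf.coeff_one_of_decomposable hd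
    have hB1 : (ChordHopf.chordGenerating B.cls).coeff 1 = 0 := by
      induction B using Quot.ind with
      | _ D =>
        have hn : (1 : ℕ) ≠ D.word.length / 2 := (lt_of_lt_of_le one_lt_two hB).ne
        exact (congrArg (Polynomial.coeff · 1) (ChordHopf.chordGenerating_cls D)).trans
          (by simp [Polynomial.coeff_X_pow, hn])
    rw [map_sub, Polynomial.coeff_sub, hB1, zero_sub, neg_eq_zero] at h1
    have h := ChordHopf.isFeps_primitive hFε hF hp
    rw [ChordHopf.chordGenerating_eq_zero hp h1, map_zero, add_zero] at h
    exact ⟨⟨_, h⟩, h⟩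
  · induction B using Quot.ind with
    | _ D =>
      obtain ⟨a, ha⟩ := ChordHopf.exists_word_of_numChords_eq_one D hB
      have hp := ChordHopf.primitive_of_oneChord D ha
      refine ⟨congrArg Fε (hπ.1.map_id _ hp), (ChordHopf.isFeps_primitive hFε hF hp).trans ?_⟩
      rw [ChordHopf.isF_oneChord hF D ha, ChordHopf.chordGenerating_cls, ha]
      simp [ChordHopf.varN, add_assoc]
end
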